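/- **Corollary 5.** Consider an online optimization problem with partial feedback over $T$ rounds: a finite action set $\mathcal A$; environment parameters $\Theta\in\mathcal O$ with prior $\mathbb P_\Theta$; in each round $t=1,\dots,T$ an outcome vector $Y_t=(Y_{t,a})_{a\in\mathcal A}$ with entries in $\mathcal Y'$, drawn from a fixed kernel $\mathbb P_{Y|\Theta}$ independently of the past given $\Theta$; a static state $S$ independent of $\Theta$ and of the outcomes; and a reward $r(Y_t,a)=r'(Y_{t,a})$ with values in $[0,1]$ (the spaces $\mathcal O$ and $\mathcal Y'$ are standard Borel, the maps measurable). Let $\gamma^\star:\mathcal O\to\mathcal A$ be an optimal rule, i.e. playing $\gamma^\star(\Theta)$ in every round attains the maximum of $\mathbb E[\sum_{t=1}^T r(Y_t,\psi_t(S,\Theta))]$ over all policies $\psi$ that know $S$ and $\Theta$, and let $A^\star=\gamma^\star(\Theta)$. Let $\hat H^t=((\hat A_1,Y_{1,\hat A_1}),\dots,(\hat A_{t-1},Y_{t-1,\hat A_{t-1}}))$ be the history under Thompson sampling: in round $t$, $\hat\Theta_t$ is drawn from the posterior $\mathbb P_{\Theta|\hat H^t}$, conditionally independently of $(\Theta,Y_t)$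 given $\hat H^t$, the action $\hat A_t=\gamma^\star(\hat\Theta_t)$ is played and $Y_{t,\hat A_t}$ is observed. Let $\mathbb W(\mathbb P,\mathbb Q)=\inf_{\mathbb D}\mathbb D(\{(y,y'):y\ne y'\})$, the infimum over all couplings $\mathbb D$ of $\mathbb P$ and $\mathbb Q$, be the Wasserstein distance of order one for the discrete metric on $\mathcal Y'$, and let $\mathrm H(A^\star)=-\sum_a\mathbb P(A^\star=a)\log\mathbb P(A^\star=a)$ (natural logarithm). Then $$\sum_{t=1}^T\mathbb E\big[\mathbb W(\mathbb P_{Y_{t,A^\star}|A^\star,\hat H^t},\,\mathbb P_{Y_{t,A^\star}|\hat H^t})\big]\le\sqrt{\tfrac12\,|\mathcal A|\,\mathrm H(A^\star)\,T},$$ where, on the event $A^\star=a$, the two laws are $\mathbb P_{Y_{t,a}|A^\star=a,\hat H^t}$ and $\mathbb P_{Y_{t,a}|\hat H^t}$ (the component index is fixed at the value of $A^\star$ before conditioning on $\hat H^t$ alone). If moreover the outcome is perfectly revealed by each per-action outcome, i.e. for every $a\in\mathcal A$ there is a measurable $f_a:\mathcal Y'\to\mathcal Y'^{\mathcal A}$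 with $Y_t=f_a(Y_{t,a})$ almost surely, then $$\sum_{t=1}^T\mathbb E\big[\mathbb W(\mathbb P_{Y_{t,A^\star}|A^\star,\hat H^t},\,\mathbb P_{Y_{t,A^\star}|\hat H^t})\big]\le\sqrt{\tfrac12\,\mathrm H(A^\star)\,T}.$$ -/

import Mathlib

open MeasureTheory ProbabilityTheory
open scoped ENNReal

noncomputable section

/-- An online optimization problem with partial feedback, as a static-state Bayesian decision
problem: a (constant) state `S ∼ stateLaw`, environment parameters `Θ ∼ prior`, and, at every round,
an outcome vector `Y_t = (Y_{t,a})_{a ∈ A}` drawn from `outcome Θ` independently of the past given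
`Θ`. The state is independent of the parameters and the outcomes. The reward of action `a` under the
outcome `y` is `pref (y a)`. -/
structure PartialFeedbackProblem (S O A Y : Type*) [MeasurableSpace S] [MeasurableSpace O]
    [MeasurableSpace Y] where
  stateLaw : Measure S
  stateLaw_prob : IsProbabilityMeasure stateLaw
  prior : Measure O
  prior_prob : IsProbabilityMeasure prior
  outcome : Kernel O (A → Y)
  outcome_markov : IsMarkovKernel outcome
  pref : Y → ℝ
  pref_measurable : Measurable pref

attribute [instance] PartialFeedbackProblem.stateLaw_prob PartialFeedbackProblem.prior_prob
  PartialFeedbackProblem.outcome_markov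

/-- Kantorovich cost of order one between `μ` and `ν` for the cost `c`: infimum over all couplings
of the expected cost. -/
def wassersteinOne {X : Type*} [MeasurableSpace X] (c : X → X → ℝ≥0∞) (μ ν : Measure X) : ℝ≥0∞ :=
  ⨅ (D : Measure (X × X)) (_ : D.map Prod.fst = μ) (_ : D.map Prod.snd = ν), ∫⁻ p, c p.1 p.2 ∂D

open Classical in
/-- The discrete metric (Hamming distortion). -/
def discreteMetric {X : Type*} (x y : X) : ℝ≥0∞ := if x = y then 0 else 1

namespace PartialFeedbackProblem

variable {S O A Y : Type*} [MeasurableSpace S] [MeasurableSpace O] [MeasurableSpace A]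
  [MeasurableSpace Y]

/-- The reward function `r(y, a) = r'(y_a)`. -/
def reward (P : PartialFeedbackProblem S O A Y) (y : A → Y) (a : A) : ℝ := P.pref (y a)

/-- Expected cumulative reward over `T` rounds of an agent that knows `Θ` and plays `ψ_t(S, Θ)`. -/
def informedReward (P : PartialFeedbackProblem S O A Y) (T : ℕ) (ψ : ℕ → S × O → A) : ℝ :=
  ∑ t ∈ Finset.range T,
    ∫ p, P.reward p.2 (ψ t p.1) ∂((P.stateLaw.prod P.prior) ⊗ₘ (Kernel.prodMkLeft S P.outcome))

/-- `γ` is an optimal decision rule: always playing `γ(Θ)` attains the maximal expected cumulative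
reward among all (measurable) policies that know `S` and `Θ`. -/
def IsOptimalRule (P : PartialFeedbackProblem S O A Y) (T : ℕ) (γ : O → A) : Prop :=
  Measurable γ ∧
    ∀ ψ : ℕ → S × O → A, (∀ t, Measurable (ψ t)) →
      P.informedReward T ψ ≤ P.informedReward T (fun _ p => γ p.2)

/-- Shannon entropy (in nats) of the optimal action `A⋆ = γ(Θ)`. -/
def optEntropy [Fintype A] (P : PartialFeedbackProblem S O A Y) (γ : O → A) : ℝ :=
  ∑ a, Real.negMulLog ((P.prior.map γ).real {a})

/-- The outcome vector is perfectly revealed by each of its components: for every action `a` there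
is a measurable map recovering `Y_t` almost surely from `Y_{t,a}`. -/
def PerfectlyRevealed (P : PartialFeedbackProblem S O A Y) : Prop :=
  ∀ a : A, ∃ f : Y → A → Y, Measurable f ∧ ∀ᵐ θ ∂P.prior, ∀ᵐ y ∂(P.outcome θ), f (y a) = y

/-- Joint law of `Θ` and of the history of the first `t` rounds
`((Â_1, Y_{1,Â_1}), …, (Â_t, Y_{t,Â_t}))` under Thompson sampling: in each round, given the history
`h` and `Θ = θ`, a parameter `Θ̂` is drawn from the posterior of `Θ` given `h` and, independently,
an outcome `y` from `outcome θ`; the action `γ(Θ̂)` is played and `y (γ(Θ̂))` is observed. -/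
def thompsonLaw [StandardBorelSpace O] [Nonempty O] (P : PartialFeedbackProblem S O A Y)
    (γ : O → A) : (t : ℕ) → FiniteMeasure (O × (Fin t → A × Y))
  | 0 => ⟨P.prior.map (fun θ => (θ, Fin.elim0)), inferInstance⟩
  | t + 1 =>
    let μ : Measure (O × (Fin t → A × Y)) := P.thompsonLaw γ t
    let posterior : Kernel (Fin t → A × Y) O := condDistrib Prod.fst Prod.snd μ
    ⟨(μ ⊗ₘ (Kernel.prodMkLeft O posterior ×ₖ Kernel.prodMkRight (Fin t → A × Y) P.outcome)).map
      (fun p => (p.1.1, Fin.snoc (α := fun _ => A × Y) p.1.2 (γ p.2.1, p.2.2 (γ p.2.1)))),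
      inferInstance⟩

variable [StandardBorelSpace O] [Nonempty O]

/-- Joint law of `((Θ, Ĥ), Y)`, where `Ĥ` is the history of the first `t` rounds of Thompson
sampling and `Y` is the full outcome vector of the following round. -/
def roundLaw (P : PartialFeedbackProblem S O A Y) (γ : O → A) (t : ℕ) :
    Measure ((O × (Fin t → A × Y)) × (A → Y)) :=
  (P.thompsonLaw γ t : Measure (O × (Fin t → A × Y))) ⊗ₘ
    (Kernel.prodMkRight (Fin t → A × Y) P.outcome)

instance (P : PartialFeedbackProblem S O A Y) (γ : O → A) (t : ℕ) :
    IsFiniteMeasure (P.roundLaw γ t) := by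
  unfold roundLaw; infer_instance

variable [StandardBorelSpace Y] [Nonempty Y]

/-- The conditional law `P_{Y_a | A⋆ = b, Ĥ = h}`, with `A⋆ = γ(Θ)`. -/
def outcomeGivenOptHist (P : PartialFeedbackProblem S O A Y) (γ : O → A) (t : ℕ) (a b : A)
    (h : Fin t → A × Y) : Measure Y :=
  condDistrib (fun ω => ω.2 a) (fun ω => (γ ω.1.1, ω.1.2)) (P.roundLaw γ t) (b, h)

/-- The conditional law `P_{Y_a | Ĥ = h}`. -/
def outcomeGivenHist (P : PartialFeedbackProblem S O A Y) (γ : O → A) (t : ℕ) (a : A)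
    (h : Fin t → A × Y) : Measure Y :=
  condDistrib (fun ω => ω.2 a) (fun ω => ω.1.2) (P.roundLaw γ t) h

/-- The bound `∑_t 𝔼[W(P_{Y_{t,A⋆} | A⋆, Ĥ^t}, P_{Y_{t,A⋆} | Ĥ^t})]` with the discrete metric on the
per-action outcomes. In both laws the index of the component is frozen at the value of `A⋆`, i.e.
on `A⋆ = a` they are `P_{Y_{t,a} | A⋆ = a, Ĥ^t}` and `P_{Y_{t,a} | Ĥ^t}`. -/
def wassersteinBound (P : PartialFeedbackProblem S O A Y) (γ : O → A) (T : ℕ) : ℝ≥0∞ :=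
  ∑ t ∈ Finset.range T,
    ∫⁻ ω, wassersteinOne discreteMetric
      (P.outcomeGivenOptHist γ t (γ ω.1) (γ ω.1) ω.2)
      (P.outcomeGivenHist γ t (γ ω.1) ω.2) ∂(P.thompsonLaw γ t : Measure (O × (Fin t → A × Y)))

end PartialFeedbackProblem

end

/-! Fix a round and write p_a = ℙ(A⋆ = a | Ĥ) and x_{a,b} = ℙ(A⋆ = b | Ĥ, Y_a). By Bayes' rule p_a
times the law of Y_a given A⋆ = a, Ĥ has density x_{a,a} with respect to the law of Y_a given Ĥ, and
the overlap coupling bounds the discrete Wasserstein distance by total variation. Hence the expected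
distance in the round is at most ∑_a 𝔼[(p_a − x_{a,a})⁺] (`lintegral_wassersteinOne_le_expectedTV`).

Given Ĥ, the sampled action equals a with probability p_a, independently of Θ and of the outcome. So
∑_{a,b} 𝔼[p_a D(x_{a,b}, p_b)], where D is `relEntropyTerm`, is the information about A⋆ gained in
the round, and equals the drop in expected posterior entropy (`sum_integral_relEntropyTerm`). These
drops telescope to at most H(A⋆).

A linearized Pinsker inequality, with a free parameter l > 0, links the two
(`max_sub_le_relEntropyTerm`). Its first-order term integrates to zero since x_{a,a} averages to
p_a. With parameter l·p_a, the diagonal terms 𝔼[p_a D(x_{a,a}, p_a)] appear, and each action costs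
at most 1/(4l), whence the factor |A|. Under perfect revelation x_{a,b} does not depend on a, the
weights p_a sum to one, and the plain parameter l gives remainders p_a/(4l) that total 1/(4l).
Keeping l free until all rounds are summed replaces Cauchy–Schwarz. -/

/-! ### A pointwise form of Pinsker's inequality -/

/-- The summand `x log (x / p) - x + p` of the relative entropy. -/
noncomputable def relEntropyTerm (x p : ℝ) : ℝ := x * Real.log x - x * Real.log p - x + p

/-- The difference of the two sides has derivative 4(u+1) log u − 8(u−1), which is increasing and
vanishes at 1; so the difference is smallest at u = 1, where it is 0. -/
lemma three_mul_sq_le_klFun {u : ℝ} (hu : 0 ≤ u) :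
    3 * (u - 1) ^ 2 ≤ (2 * u + 4) * InformationTheory.klFun u := by
  set ψ : ℝ → ℝ := fun u => (2 * u + 4) * InformationTheory.klFun u - 3 * (u - 1) ^ 2 with hψ
  set ψ' : ℝ → ℝ := fun u => 4 * (u + 1) * Real.log u - 8 * (u - 1) with hψ'
  have hd : ∀ u : ℝ, u ≠ 0 → HasDerivAt ψ (ψ' u) u := by
    intro u hu
    have h1 : HasDerivAt (fun u : ℝ => 2 * u + 4) 2 u := by
      simpa using ((hasDerivAt_id u).const_mul 2).add_const 4
    have h2 : HasDerivAt (fun u : ℝ => 3 * (u - 1) ^ 2) (6 * (u - 1)) u := by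
      refine ((((hasDerivAt_id u).sub_const 1).pow 2).const_mul 3).congr_deriv ?_
      simp only [id]; push_cast; ring
    refine ((h1.mul (InformationTheory.hasDerivAt_klFun hu)).sub h2).congr_deriv ?_
    simp only [hψ', InformationTheory.klFun]; ring
  have hd' : ∀ u : ℝ, u ≠ 0 → HasDerivAt ψ' (4 * (Real.log u - (1 - u⁻¹))) u := by
    intro u hu
    have h1 : HasDerivAt (fun u : ℝ => 4 * (u + 1)) 4 u := by
      simpa using ((hasDerivAt_id u).add_const 1).const_mul 4
    have h2 : HasDerivAt (fun u : ℝ => 8 * (u - 1)) 8 u := by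
      simpa using ((hasDerivAt_id u).sub_const 1).const_mul 8
    refine ((h1.mul (Real.hasDerivAt_log hu)).sub h2).congr_deriv ?_
    field_simp; ring
  have hcont : Continuous ψ := by
    have := InformationTheory.continuous_klFun
    fun_prop
  have hmono' : MonotoneOn ψ' (Set.Ioi 0) := by
    apply monotoneOn_of_deriv_nonneg (convex_Ioi 0)
    · exact fun x hx => (hd' x (ne_of_gt hx)).continuousAt.continuousWithinAt
    · rw [interior_Ioi]
      exact fun x hx => (hd' x (ne_of_gt hx)).differentiableAt.differentiableWithinAt
    · rw [interior_Ioi]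
      intro x hx
      rw [(hd' x (ne_of_gt hx)).deriv]
      have := Real.one_sub_inv_le_log_of_pos hx
      linarith
  have h1 : ψ' 1 = 0 := by simp [hψ']
  have hψ1 : ψ 1 = 0 := by simp [hψ, InformationTheory.klFun_one]
  suffices h : 0 ≤ ψ u by simp only [hψ] at h; linarith
  rcases le_total u 1 with h | h
  · have : AntitoneOn ψ (Set.Icc 0 1) := by
      apply antitoneOn_of_deriv_nonpos (convex_Icc 0 1) hcont.continuousOn
      · rw [interior_Icc]
        exact fun x hx => (hd x hx.1.ne').differentiableAt.differentiableWithinAt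
      · rw [interior_Icc]
        intro x hx
        rw [(hd x hx.1.ne').deriv, ← h1]
        exact hmono' hx.1 (Set.mem_Ioi.2 one_pos) hx.2.le
    rw [← hψ1]
    exact this ⟨hu, h⟩ ⟨zero_le_one, le_rfl⟩ h
  · have : MonotoneOn ψ (Set.Ici 1) := by
      apply monotoneOn_of_deriv_nonneg (convex_Ici 1) hcont.continuousOn
      · rw [interior_Ici]
        exact fun x hx =>
          (hd x (one_pos.trans hx).ne').differentiableAt.differentiableWithinAt
      · rw [interior_Ici]
        intro x hx
        rw [(hd x (one_pos.trans hx).ne').deriv, ← h1]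
        exact hmono' (Set.mem_Ioi.2 one_pos) (Set.mem_Ioi.2 (one_pos.trans hx)) (le_of_lt hx)
    rw [← hψ1]
    exact this (Set.mem_Ici.2 le_rfl) h h

lemma relEntropyTerm_eq_klFun {x p : ℝ} (hx : 0 ≤ x) (hp : 0 < p) :
    relEntropyTerm x p = p * InformationTheory.klFun (x / p) := by
  rcases hx.eq_or_lt with rfl | hx
  · simp [relEntropyTerm, InformationTheory.klFun]
  · rw [relEntropyTerm, InformationTheory.klFun, Real.log_div hx.ne' hp.ne']
    field_simp; ring

/-- The last hypothesis is absolute continuity. With the convention log 0 = 0 the term at p = 0 is x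
log x − x, which is negative for small x > 0. -/
lemma relEntropyTerm_nonneg {x p : ℝ} (hx : 0 ≤ x) (hp : 0 ≤ p) (h : p = 0 → x = 0) :
    0 ≤ relEntropyTerm x p := by
  rcases hp.eq_or_lt with rfl | hp
  · simp [relEntropyTerm, h rfl]
  · rw [relEntropyTerm_eq_klFun hx hp]
    exact mul_nonneg hp.le (InformationTheory.klFun_nonneg (div_nonneg hx hp.le))

lemma three_mul_sq_le_relEntropyTerm {x p : ℝ} (hx : 0 ≤ x) (hp : 0 < p) :
    3 * (x - p) ^ 2 ≤ (2 * x + 4 * p) * relEntropyTerm x p := by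
  have h := mul_le_mul_of_nonneg_left (three_mul_sq_le_klFun (div_nonneg hx hp.le)) (sq_nonneg p)
  rw [relEntropyTerm_eq_klFun hx hp]
  have e1 : p ^ 2 * (3 * (x / p - 1) ^ 2) = 3 * (x - p) ^ 2 := by field_simp
  have e2 : p ^ 2 * ((2 * (x / p) + 4) * InformationTheory.klFun (x / p))
      = (2 * x + 4 * p) * (p * InformationTheory.klFun (x / p)) := by field_simp
  rwa [e1, e2] at h

/-- Linearized Pinsker inequality for one summand. -/
lemma max_sub_le_relEntropyTerm {x p l : ℝ} (hx : 0 ≤ x) (hp : 0 ≤ p) (h : p = 0 → x = 0)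
    (hl : 0 < l) :
    max (p - x) 0 ≤ (p - x) / 2 + l / 2 * relEntropyTerm x p + (x + 2 * p) / (12 * l) := by
  rcases hp.eq_or_lt with rfl | hp
  · simp [relEntropyTerm, h rfl]
  have hD := relEntropyTerm_nonneg hx hp.le h
  have hP := three_mul_sq_le_relEntropyTerm hx hp
  set D := relEntropyTerm x p
  have hv : 0 < (x + 2 * p) / (12 * l) := by positivity
  have hmul : l / 2 * D * ((x + 2 * p) / (12 * l)) = (2 * x + 4 * p) * D / 48 := by
    field_simp; ring
  set v := (x + 2 * p) / (12 * l)
  have hu : 0 ≤ l / 2 * D := by positivity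
  set u := l / 2 * D
  -- By `hmul` and `hP`, uv ≥ (p − x)²/16; conclude with 4uv ≤ (u + v)².
  have key : |p - x| / 2 ≤ u + v := by
    apply abs_le_of_sq_le_sq' _ (by positivity) |>.2
    rw [div_pow, sq_abs]
    nlinarith [sq_nonneg (u - v)]
  have : max (p - x) 0 = (p - x) / 2 + |p - x| / 2 := by
    rcases le_total (p - x) 0 with h | h
    · rw [max_eq_right h, abs_of_nonpos h]; ring
    · rw [max_eq_left h, abs_of_nonneg h]; ring
  linarith

/-- If `W ≤ l / 2 * H + C / (2 * l)` for every `l > 0`, then `W ≤ √(H * C)`. -/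
lemma le_sqrt_mul_of_forall_le {W H C : ℝ} (hH : 0 ≤ H) (hC : 0 ≤ C)
    (h : ∀ l : ℝ, 0 < l → W ≤ l / 2 * H + C / (2 * l)) : W ≤ Real.sqrt (H * C) := by
  -- The minimizer l = √(C/H) is unavailable when H or C vanishes, so both are shifted by ε and ε →
  -- 0 at the end.
  have aux : ∀ ε : ℝ, 0 < ε → W ≤ Real.sqrt ((H + ε) * (C + ε)) := by
    intro ε hε
    have ha : 0 < H + ε := by linarith
    have hb : 0 < C + ε := by linarith
    have hsa := Real.sqrt_pos.2 ha
    have hsb := Real.sqrt_pos.2 hb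
    refine (h (Real.sqrt (C + ε) / Real.sqrt (H + ε)) (by positivity)).trans ?_
    have h1 : Real.sqrt (C + ε) / Real.sqrt (H + ε) / 2 * H
        ≤ Real.sqrt (C + ε) / Real.sqrt (H + ε) / 2 * (H + ε) := by gcongr; linarith
    have h2 : C / (2 * (Real.sqrt (C + ε) / Real.sqrt (H + ε)))
        ≤ (C + ε) / (2 * (Real.sqrt (C + ε) / Real.sqrt (H + ε))) := by gcongr; linarith
    refine (add_le_add h1 h2).trans (le_of_eq ?_)
    rw [Real.sqrt_mul ha.le]
    have e1 := Real.sq_sqrt ha.le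
    have e2 := Real.sq_sqrt hb.le
    generalize Real.sqrt (H + ε) = s at *
    generalize Real.sqrt (C + ε) = r at *
    rw [← e1, ← e2]
    field_simp; ring
  have hc : Filter.Tendsto (fun ε : ℝ => Real.sqrt ((H + ε) * (C + ε)))
      (nhdsWithin 0 (Set.Ioi 0)) (nhds (Real.sqrt (H * C))) := by
    have : Continuous fun ε : ℝ => Real.sqrt ((H + ε) * (C + ε)) := by fun_prop
    simpa using (this.tendsto 0).mono_left nhdsWithin_le_nhds
  exact ge_of_tendsto hc (by filter_upwards [self_mem_nhdsWithin] with ε hε using aux ε hε)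

/-! ### Couplings for the discrete metric -/

/-- The overlap coupling: the discrete Wasserstein distance is bounded by the total variation
distance, expressed through the density of `c • μ` with respect to `ν`. -/
lemma mul_wassersteinOne_discreteMetric_le {X : Type*} [MeasurableSpace X] {μ ν : Measure X}
    [IsProbabilityMeasure μ] [IsProbabilityMeasure ν] {c : ℝ≥0∞} (hc0 : c ≠ 0) (hc : c ≠ ∞)
    {g : X → ℝ≥0∞} (hg : Measurable g) (h : c • μ = ν.withDensity g) :
    c * wassersteinOne discreteMetric μ ν ≤ ∫⁻ y, (c - g y) ∂ν := by
  set f : X → ℝ≥0∞ := fun y => c⁻¹ * g y with hf_def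
  have hf : Measurable f := hg.const_mul _
  have hμ : μ = ν.withDensity f := by
    have : c⁻¹ • c • μ = c⁻¹ • ν.withDensity g := by rw [h]
    rwa [smul_smul, ENNReal.inv_mul_cancel hc0 hc, one_smul, ← withDensity_smul _ hg] at this
  -- `m` is the common part of μ and ν; `μ'` and `ν'` are the excesses, of equal mass δ.
  set m := ν.withDensity (fun y => min (f y) 1) with hm
  set μ' := ν.withDensity (fun y => f y - 1) with hμ'
  set ν' := ν.withDensity (fun y => 1 - f y) with hν'
  have hmμ : m + μ' = μ := by
    rw [hm, hμ', ← withDensity_add_left (by fun_prop), hμ]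
    congr 1; ext y
    simp only [Pi.add_apply]
    rcases le_total (f y) 1 with h | h
    · rw [min_eq_left h, tsub_eq_zero_of_le h, add_zero]
    · rw [min_eq_right h, add_tsub_cancel_of_le h]
  have hmν : m + ν' = ν := by
    rw [hm, hν', ← withDensity_add_left (by fun_prop)]
    conv_rhs => rw [← withDensity_one (μ := ν)]
    congr 1; ext y
    simp only [Pi.add_apply, Pi.one_apply]
    rcases le_total (f y) 1 with h | h
    · rw [min_eq_left h, add_tsub_cancel_of_le h]
    · rw [min_eq_right h, tsub_eq_zero_of_le h, add_zero]
  have hle : ∀ (n : Measure X), m + n = ν → n Set.univ ≤ 1 := fun n hn => by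
    rw [← measure_univ (μ := ν), ← hn]; simp
  have hν'1 : ν' Set.univ ≤ 1 := hle _ hmν
  have hm1 : m Set.univ ≤ 1 := by rw [← measure_univ (μ := ν), ← hmν]; simp
  have hδ : μ' Set.univ = ν' Set.univ := by
    have h1 : m Set.univ + μ' Set.univ = 1 := by
      rw [← Measure.add_apply, hmμ, measure_univ]
    have h2 : m Set.univ + ν' Set.univ = 1 := by
      rw [← Measure.add_apply, hmν, measure_univ]
    exact (ENNReal.add_right_inj (hm1.trans_lt ENNReal.one_lt_top).ne).1 (h1.trans h2.symm)
  set δ := ν' Set.univ with hδ_def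
  have hδt : δ ≠ ∞ := (hν'1.trans_lt ENNReal.one_lt_top).ne
  have hfin : IsFiniteMeasure ν' := ⟨hδt.lt_top⟩
  have hfin' : IsFiniteMeasure μ' := ⟨by rw [hδ]; exact hδt.lt_top⟩
  -- This also covers δ = 0, where δ⁻¹ = ∞ but the measure is zero.
  have hcancel : ∀ n : Measure X, n Set.univ = δ → δ⁻¹ • δ • n = n := by
    intro n hn
    by_cases h0 : δ = 0
    · rw [h0] at hn
      rw [Measure.measure_univ_eq_zero.1 hn]; simp
    · rw [smul_smul, ENNReal.inv_mul_cancel h0 hδt, one_smul]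
  -- Common mass stays on the diagonal at no cost; the excesses are coupled independently.
  set D : Measure (X × X) := m.map (fun x => (x, x)) + δ⁻¹ • μ'.prod ν' with hD
  have hD1 : D.map Prod.fst = μ := by
    rw [hD, Measure.map_add _ _ measurable_fst, Measure.map_smul, Measure.map_fst_prod,
      Measure.map_map measurable_fst (by fun_prop), ← hδ_def, hcancel _ hδ]
    simpa [Function.comp_def] using hmμ
  have hD2 : D.map Prod.snd = ν := by
    rw [hD, Measure.map_add _ _ measurable_snd, Measure.map_smul, Measure.map_snd_prod,
      Measure.map_map measurable_snd (by fun_prop), hδ, hcancel _ rfl]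
    simpa [Function.comp_def] using hmν
  have hcost : ∫⁻ p, discreteMetric p.1 p.2 ∂D ≤ δ := by
    rw [hD, lintegral_add_measure, lintegral_smul_measure]
    -- The inequality `lintegral_map_le` suffices, and needs no measurability of the diagonal.
    have h1 : ∫⁻ p, discreteMetric p.1 p.2 ∂(m.map fun x => (x, x)) ≤ 0 :=
      (lintegral_map_le _ _).trans (by simp [discreteMetric])
    have h2 : ∫⁻ p, discreteMetric p.1 p.2 ∂(μ'.prod ν') ≤ δ * δ := by
      calc ∫⁻ p, discreteMetric p.1 p.2 ∂(μ'.prod ν')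
          ≤ ∫⁻ _, 1 ∂(μ'.prod ν') :=
            lintegral_mono fun p => by unfold discreteMetric; split_ifs <;> simp
        _ = δ * δ := by
            rw [lintegral_one, ← Set.univ_prod_univ, Measure.prod_prod, hδ]
    calc _ ≤ 0 + δ⁻¹ * (δ * δ) := by
            rw [smul_eq_mul]; gcongr
      _ = δ⁻¹ * δ * δ := by rw [zero_add, mul_assoc]
      _ ≤ 1 * δ := by gcongr; exact ENNReal.inv_mul_le_one δ
      _ = δ := one_mul δ
  calc c * wassersteinOne discreteMetric μ ν ≤ c * δ := by
        gcongr
        exact (iInf_le_of_le D (iInf_le_of_le hD1 (iInf_le _ hD2))).trans hcost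
    _ = c * ∫⁻ y, (1 - f y) ∂ν := by
        rw [hδ_def, hν', withDensity_apply _ MeasurableSet.univ, Measure.restrict_univ]
    _ = ∫⁻ y, c * (1 - f y) ∂ν := (lintegral_const_mul _ (by fun_prop)).symm
    _ = ∫⁻ y, (c - g y) ∂ν := by
        refine lintegral_congr fun y => ?_
        rw [ENNReal.mul_sub (fun _ _ => hc), mul_one, hf_def, ← mul_assoc,
          ENNReal.mul_inv_cancel hc0 hc, one_mul]

/-! ### Versions of conditional probabilities -/

/-- `q` is a version, with values in `[0, 1]`, of the conditional probability of the event `E`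
given `X`. -/
structure IsCondProb {Ω α : Type*} [MeasurableSpace Ω] [MeasurableSpace α] (μ : Measure Ω)
    (E : Set Ω) (X : Ω → α) (q : α → ℝ≥0∞) : Prop where
  measurable : Measurable q
  le_one : ∀ x, q x ≤ 1
  setLIntegral_eq : ∀ f : α → ℝ≥0∞, Measurable f →
    ∫⁻ ω in E, f (X ω) ∂μ = ∫⁻ ω, q (X ω) * f (X ω) ∂μ

section CondProb

variable {Ω α β : Type*} [MeasurableSpace Ω] [MeasurableSpace α] [MeasurableSpace β]
  {μ : Measure Ω} {E : Set Ω} {X : Ω → α} {q q' : α → ℝ≥0∞}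

lemma isCondProb_condDistrib [IsFiniteMeasure μ] {O : Type*} [MeasurableSpace O]
    [StandardBorelSpace O] [Nonempty O] {Θ : Ω → O} (hΘ : Measurable Θ) (hX : Measurable X)
    {s : Set O} (hs : MeasurableSet s) :
    IsCondProb μ (Θ ⁻¹' s) X (fun x => condDistrib Θ X μ x s) where
  measurable := Kernel.measurable_coe _ hs
  le_one _ := prob_le_one
  setLIntegral_eq f hf := by
    have hF : Measurable fun p : α × O => s.indicator 1 p.2 * f p.1 :=
      ((measurable_one.indicator hs).comp measurable_snd).mul (hf.comp measurable_fst)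
    calc ∫⁻ ω in Θ ⁻¹' s, f (X ω) ∂μ = ∫⁻ ω, s.indicator 1 (Θ ω) * f (X ω) ∂μ := by
          rw [← lintegral_indicator (hΘ hs)]
          refine lintegral_congr fun ω => ?_
          by_cases h : Θ ω ∈ s <;> simp [Set.indicator, h]
      _ = ∫⁻ p, s.indicator 1 p.2 * f p.1 ∂(μ.map fun ω => (X ω, Θ ω)) :=
          (lintegral_map hF (hX.prodMk hΘ)).symm
      _ = ∫⁻ x, condDistrib Θ X μ x s * f x ∂(μ.map X) := by
          rw [← compProd_map_condDistrib hΘ.aemeasurable, Measure.lintegral_compProd hF]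
          refine lintegral_congr fun x => ?_
          dsimp only
          rw [lintegral_mul_const _ (measurable_one.indicator hs), lintegral_indicator_one hs]
      _ = ∫⁻ ω, condDistrib Θ X μ (X ω) s * f (X ω) ∂μ :=
          lintegral_map ((Kernel.measurable_coe _ hs).mul hf) hX

namespace IsCondProb

lemma ne_top (h : IsCondProb μ E X q) (x : α) : q x ≠ ∞ :=
  ((h.le_one x).trans_lt ENNReal.one_lt_top).ne

lemma toReal_mem_Icc (h : IsCondProb μ E X q) (x : α) : (q x).toReal ∈ Set.Icc (0 : ℝ) 1 :=
  ⟨ENNReal.toReal_nonneg, ENNReal.toReal_le_of_le_ofReal zero_le_one (by simpa using h.le_one x)⟩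

lemma ae_eq [IsFiniteMeasure μ] (h : IsCondProb μ E X q) (h' : IsCondProb μ E X q')
    (hX : Measurable X) : ∀ᵐ ω ∂μ, q (X ω) = q' (X ω) := by
  refine ae_of_ae_map hX.aemeasurable (p := fun x => q x = q' x) ?_
  refine ae_eq_of_forall_setLIntegral_eq_of_sigmaFinite h.measurable h'.measurable ?_
  intro s hs _
  have aux : ∀ {q : α → ℝ≥0∞}, IsCondProb μ E X q →
      ∫⁻ x in s, q x ∂(μ.map X) = ∫⁻ ω in E, s.indicator 1 (X ω) ∂μ := by
    intro q h
    rw [h.setLIntegral_eq _ (measurable_one.indicator hs), ← lintegral_indicator hs,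
      lintegral_map (h.measurable.indicator hs) hX]
    refine lintegral_congr fun ω => ?_
    by_cases hω : X ω ∈ s <;> simp [Set.indicator, hω]
  rw [aux h, aux h']

/-- Testing the defining identity on the indicator of {q = 0} shows that E carries no mass there.
This permits division by q on E. -/
lemma ae_restrict_ne_zero (h : IsCondProb μ E X q) (hX : Measurable X) :
    ∀ᵐ ω ∂(μ.restrict E), q (X ω) ≠ 0 := by
  have hs : MeasurableSet {x | q x = 0} := h.measurable (measurableSet_singleton 0)
  have h0 := h.setLIntegral_eq _ (measurable_one.indicator hs)
  have : ∫⁻ ω, q (X ω) * ({x | q x = 0} : Set α).indicator 1 (X ω) ∂μ = 0 := by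
    rw [← lintegral_zero (μ := μ)]
    refine lintegral_congr fun ω => ?_
    by_cases hω : q (X ω) = 0 <;> simp [Set.indicator, hω]
  have hm : Measurable fun ω => ({x | q x = 0} : Set α).indicator (1 : α → ℝ≥0∞) (X ω) :=
    (measurable_one.indicator hs).comp hX
  rw [this, lintegral_eq_zero_iff hm] at h0
  filter_upwards [h0] with ω hω hq
  simp [Set.indicator, hq] at hω

variable {Z : Ω → β} {g : β → ℝ≥0∞}

/-- Both sides are the law of X restricted to E. Stated for measures, the tower property transfers
integrability and null sets as well as integrals. -/
lemma map_withDensity_eq (h : IsCondProb μ E X q) (hg : IsCondProb μ E Z g)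
    (hX : Measurable X) {φ : β → α} (hφ : Measurable φ) (hXZ : ∀ ω, X ω = φ (Z ω)) :
    (μ.withDensity fun ω => g (Z ω)).map X = (μ.withDensity fun ω => q (X ω)).map X := by
  ext s hs
  rw [Measure.map_apply hX hs, Measure.map_apply hX hs, withDensity_apply _ (hX hs),
    withDensity_apply _ (hX hs), ← lintegral_indicator (hX hs), ← lintegral_indicator (hX hs)]
  have h1 := h.setLIntegral_eq _ (measurable_one.indicator hs)
  have h2 := hg.setLIntegral_eq _ ((measurable_one.indicator hs).comp hφ)
  simp only [Function.comp_apply, ← hXZ] at h2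
  refine Eq.trans ?_ ((h2.symm.trans h1).trans ?_) <;> refine lintegral_congr fun ω => ?_ <;>
  by_cases hω : X ω ∈ s <;> simp [Set.indicator, hω]

/-- Tower property: refining the conditioning does not change integrals against functions of the
coarser variable. -/
lemma integrable_and_integral_eq (h : IsCondProb μ E X q) (hg : IsCondProb μ E Z g)
    (hX : Measurable X) (hZ : Measurable Z) {φ : β → α} (hφ : Measurable φ)
    (hXZ : ∀ ω, X ω = φ (Z ω)) {f : α → ℝ} (hf : Measurable f)
    (hint : Integrable (fun ω => (q (X ω)).toReal * f (X ω)) μ) :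
    Integrable (fun ω => (g (Z ω)).toReal * f (X ω)) μ ∧
      ∫ ω, (g (Z ω)).toReal * f (X ω) ∂μ = ∫ ω, (q (X ω)).toReal * f (X ω) ∂μ := by
  have hm := h.map_withDensity_eq hg hX hφ hXZ
  have hgt : ∀ᵐ ω ∂μ, g (Z ω) < ∞ := .of_forall fun ω => (hg.ne_top _).lt_top
  have hqt : ∀ᵐ ω ∂μ, q (X ω) < ∞ := .of_forall fun ω => (h.ne_top _).lt_top
  have hgm : Measurable fun ω => g (Z ω) := hg.measurable.comp hZ
  have hqm : Measurable fun ω => q (X ω) := h.measurable.comp hX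
  have hfm : ∀ ν : Measure α, AEStronglyMeasurable f ν := fun ν => hf.aestronglyMeasurable
  have i1 : Integrable f ((μ.withDensity fun ω => q (X ω)).map X) := by
    rw [integrable_map_measure (hfm _) hX.aemeasurable,
      integrable_withDensity_iff_integrable_smul' hqm hqt]
    simpa using hint
  constructor
  · rw [← hm, integrable_map_measure (hfm _) hX.aemeasurable,
      integrable_withDensity_iff_integrable_smul' hgm hgt] at i1
    simpa using i1
  · have e := congrArg (fun ν => ∫ x, f x ∂ν) hm
    simp only [integral_map hX.aemeasurable (hfm _)] at e
    rw [integral_withDensity_eq_integral_toReal_smul hgm hgt,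
      integral_withDensity_eq_integral_toReal_smul hqm hqt] at e
    simpa using e

/-- Supplies the absolute continuity required for the relative entropy of the refined posterior with
respect to the coarser one. -/
lemma ae_eq_zero_of_eq_zero (h : IsCondProb μ E X q) (hg : IsCondProb μ E Z g)
    (hX : Measurable X) (hZ : Measurable Z) {φ : β → α} (hφ : Measurable φ)
    (hXZ : ∀ ω, X ω = φ (Z ω)) : ∀ᵐ ω ∂μ, q (X ω) = 0 → g (Z ω) = 0 := by
  have hs : MeasurableSet {x | q x = 0} := h.measurable (measurableSet_singleton 0)
  have hm := congrArg (fun ν => ν {x | q x = 0}) (h.map_withDensity_eq hg hX hφ hXZ)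
  simp only [Measure.map_apply hX hs, withDensity_apply _ (hX hs)] at hm
  have h0 : ∫⁻ ω in X ⁻¹' {x | q x = 0}, q (X ω) ∂μ = 0 := by
    rw [setLIntegral_congr_fun (g := fun _ => 0) (hX hs) (fun ω hω => hω)]; simp
  have hgm : Measurable fun ω => g (Z ω) := hg.measurable.comp hZ
  rw [h0, lintegral_eq_zero_iff hgm] at hm
  exact (ae_restrict_iff' (hX hs)).1 hm

end IsCondProb

end CondProb

/-! ### Disintegration through conditional probabilities -/

section Disintegration

variable {Ω α Y : Type*} [MeasurableSpace Ω] [MeasurableSpace α] [MeasurableSpace Y]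
  [StandardBorelSpace Y] [Nonempty Y] {μ : Measure Ω} [IsFiniteMeasure μ] {H : Ω → α} {V : Ω → Y}

lemma lintegral_lintegral_condDistrib (hH : Measurable H) (hV : Measurable V)
    {F : α × Y → ℝ≥0∞} (hF : Measurable F) :
    ∫⁻ x, ∫⁻ y, F (x, y) ∂(condDistrib V H μ x) ∂(μ.map H) = ∫⁻ ω, F (H ω, V ω) ∂μ := by
  rw [← Measure.lintegral_compProd hF, compProd_map_condDistrib hV.aemeasurable,
    lintegral_map hF (hH.prodMk hV)]

/-- Bayes' rule: the conditional law of `V` given `B = a` and `H` has density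
`ℙ(B = a | H, V) / ℙ(B = a | H)` with respect to the conditional law of `V` given `H`. -/
lemma ae_smul_condDistrib_eq_withDensity {A : Type*} [MeasurableSpace A]
    [MeasurableSingletonClass A] {B : Ω → A} (hB : Measurable B) (hH : Measurable H)
    (hV : Measurable V) {a : A} {q : α → ℝ≥0∞} {g : α × Y → ℝ≥0∞}
    (hq : IsCondProb μ (B ⁻¹' {a}) H q) (hg : IsCondProb μ (B ⁻¹' {a}) (fun ω => (H ω, V ω)) g) :
    ∀ᵐ h ∂(μ.map H), q h • condDistrib V (fun ω => (B ω, H ω)) μ (a, h)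
      = (condDistrib V H μ h).withDensity fun y => g (h, y) := by
  have hemb : Measurable fun h : α => (a, h) := by fun_prop
  set κ : Kernel α Y := (condDistrib V (fun ω => (B ω, H ω)) μ).comap _ hemb with hκ
  have hqm : Measurable (Function.uncurry fun (h : α) (_ : Y) => q h) :=
    hq.measurable.comp measurable_fst
  have hgm : Measurable (Function.uncurry fun (h : α) (y : Y) => g (h, y)) := hg.measurable
  have : IsFiniteKernel (κ.withDensity fun h _ => q h) :=
    Kernel.isFiniteKernel_withDensity_of_bounded κ (B := 1) ENNReal.one_ne_top
      fun h _ => hq.le_one h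
  have : IsFiniteKernel ((condDistrib V H μ).withDensity fun h y => g (h, y)) :=
    Kernel.isFiniteKernel_withDensity_of_bounded _ (B := 1) ENNReal.one_ne_top
      fun h y => hg.le_one (h, y)
  have hE : MeasurableSet (B ⁻¹' {a}) := hB (measurableSet_singleton a)
  -- Integrated against a test function F, both kernels give the integral of F(H, V) over {B = a}.
  have key : (κ.withDensity fun h _ => q h)
      =ᵐ[μ.map H] ((condDistrib V H μ).withDensity fun h y => g (h, y)) := by
    refine Kernel.ae_eq_of_compProd_eq (Measure.ext_of_lintegral _ fun F hF => ?_)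
    rw [Measure.lintegral_compProd hF, Measure.lintegral_compProd hF]
    have hG : Measurable fun h => ∫⁻ y, F (h, y) ∂(κ h) := hF.lintegral_kernel_prod_right'
    have hF' : ∀ h, Measurable fun y => F (h, y) := fun h => by fun_prop
    calc ∫⁻ h, ∫⁻ y, F (h, y) ∂(κ.withDensity (fun h _ => q h) h) ∂(μ.map H)
        = ∫⁻ h, q h * ∫⁻ y, F (h, y) ∂(κ h) ∂(μ.map H) := by
          refine lintegral_congr fun h => ?_
          rw [Kernel.lintegral_withDensity _ hqm _ (hF' h), lintegral_const_mul _ (hF' h)]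
      _ = ∫⁻ ω, q (H ω) * ∫⁻ y, F (H ω, y) ∂(κ (H ω)) ∂μ :=
          lintegral_map (hq.measurable.mul hG) hH
      _ = ∫⁻ ω in B ⁻¹' {a}, ∫⁻ y, F (H ω, y) ∂(κ (H ω)) ∂μ :=
          (hq.setLIntegral_eq _ hG).symm
      _ = ∫⁻ ω, ∫⁻ y, ({a} : Set A).indicator 1 (B ω) * F (H ω, y)
            ∂(condDistrib V (fun ω => (B ω, H ω)) μ (B ω, H ω)) ∂μ := by
          rw [← lintegral_indicator hE]
          refine lintegral_congr fun ω => ?_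
          rw [lintegral_const_mul _ (hF' _)]
          by_cases h : B ω = a
          · simp [hκ, h]
          · simp [Set.indicator, h]
      _ = ∫⁻ ω, ({a} : Set A).indicator 1 (B ω) * F (H ω, V ω) ∂μ := by
          have hI : Measurable fun p : (A × α) × Y =>
              ({a} : Set A).indicator 1 p.1.1 * F (p.1.2, p.2) :=
            ((measurable_one.indicator (measurableSet_singleton a)).comp
              (measurable_fst.comp measurable_fst)).mul (hF.comp (by fun_prop))
          rw [← lintegral_lintegral_condDistrib (H := fun ω => (B ω, H ω)) (hB.prodMk hH) hV hI,
            lintegral_map hI.lintegral_kernel_prod_right' (hB.prodMk hH)]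
      _ = ∫⁻ ω in B ⁻¹' {a}, F (H ω, V ω) ∂μ := by
          rw [← lintegral_indicator hE]
          refine lintegral_congr fun ω => ?_
          by_cases h : B ω = a <;> simp [Set.indicator, h]
      _ = ∫⁻ ω, g (H ω, V ω) * F (H ω, V ω) ∂μ := hg.setLIntegral_eq F hF
      _ = ∫⁻ h, ∫⁻ y, g (h, y) * F (h, y) ∂(condDistrib V H μ h) ∂(μ.map H) :=
          (lintegral_lintegral_condDistrib hH hV (hg.measurable.mul hF)).symm
      _ = _ := by
          refine lintegral_congr fun h => ?_
          rw [Kernel.lintegral_withDensity _ hgm _ (hF' h)]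
  filter_upwards [key] with h hh
  rw [Kernel.withDensity_apply _ hqm, Kernel.withDensity_apply _ hgm, withDensity_const] at hh
  exact hh

/-- The expected discrete Wasserstein distance between the laws of `V` given `B = a, H` and
given `H`, on the event `B = a`, in terms of conditional probabilities of that event. -/
lemma setLIntegral_wassersteinOne_le {A : Type*} [MeasurableSpace A]
    [MeasurableSingletonClass A] {B : Ω → A} (hB : Measurable B) (hH : Measurable H)
    (hV : Measurable V) {a : A} {q : α → ℝ≥0∞} {g : α × Y → ℝ≥0∞}
    (hq : IsCondProb μ (B ⁻¹' {a}) H q) (hg : IsCondProb μ (B ⁻¹' {a}) (fun ω => (H ω, V ω)) g) :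
    ∫⁻ ω in B ⁻¹' {a}, wassersteinOne discreteMetric
        (condDistrib V (fun ω => (B ω, H ω)) μ (a, H ω)) (condDistrib V H μ (H ω)) ∂μ
      ≤ ∫⁻ ω, (q (H ω) - g (H ω, V ω)) ∂μ := by
  have hJ : Measurable fun p : α × Y => q p.1 - g p :=
    (hq.measurable.comp measurable_fst).sub hg.measurable
  have hJ' : Measurable fun h => ∫⁻ y, (q h - g (h, y)) ∂(condDistrib V H μ h) :=
    hJ.lintegral_kernel_prod_right'
  calc ∫⁻ ω in B ⁻¹' {a}, wassersteinOne discreteMetric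
        (condDistrib V (fun ω => (B ω, H ω)) μ (a, H ω)) (condDistrib V H μ (H ω)) ∂μ
      -- The Wasserstein distance is first replaced by a measurable bound, to which the defining
      -- property of q applies; the factor q it produces then cancels q⁻¹.
      ≤ ∫⁻ ω in B ⁻¹' {a},
          (q (H ω))⁻¹ * ∫⁻ y, (q (H ω) - g (H ω, y)) ∂(condDistrib V H μ (H ω)) ∂μ := by
        refine lintegral_mono_ae ?_
        filter_upwards [hq.ae_restrict_ne_zero hH, ae_restrict_of_ae (ae_of_ae_map hH.aemeasurable
          (ae_smul_condDistrib_eq_withDensity hB hH hV hq hg))] with ω h0 hω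
        have hgω : Measurable fun y => g (H ω, y) := hg.measurable.comp (by fun_prop)
        have := mul_wassersteinOne_discreteMetric_le h0 (hq.ne_top _) hgω hω
        rw [mul_comm] at this
        exact ((ENNReal.le_div_iff_mul_le (.inl h0) (.inl (hq.ne_top _))).2 this).trans_eq
          (by rw [div_eq_mul_inv, mul_comm])
    _ = ∫⁻ ω, q (H ω) *
          ((q (H ω))⁻¹ * ∫⁻ y, (q (H ω) - g (H ω, y)) ∂(condDistrib V H μ (H ω))) ∂μ :=
        hq.setLIntegral_eq _ (hq.measurable.inv.mul hJ')
    _ ≤ ∫⁻ ω, ∫⁻ y, (q (H ω) - g (H ω, y)) ∂(condDistrib V H μ (H ω)) ∂μ := by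
        refine lintegral_mono fun ω => ?_
        rw [← mul_assoc]
        exact mul_le_of_le_one_left' (ENNReal.mul_inv_le_one _)
    _ = ∫⁻ ω, (q (H ω) - g (H ω, V ω)) ∂μ := by
        rw [← lintegral_lintegral_condDistrib hH hV hJ, lintegral_map hJ' hH]

end Disintegration

lemma measurable_finSnoc {X : Type*} [MeasurableSpace X] (t : ℕ) :
    Measurable fun p : (Fin t → X) × X => (Fin.snoc p.1 p.2 : Fin (t + 1) → X) := by
  refine measurable_pi_lambda _ fun i => ?_
  refine Fin.lastCases ?_ (fun j => ?_) i
  · simpa using measurable_snd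
  · simp only [Fin.snoc_castSucc]
    fun_prop

/-! ### Posterior probabilities of the optimal action under Thompson sampling -/

namespace PartialFeedbackProblem

section

variable {S O A Y : Type*} [MeasurableSpace S] [MeasurableSpace O] [MeasurableSpace A]
  [MeasurableSpace Y]

section

variable [StandardBorelSpace O] [Nonempty O]

/-- The posterior probability `ℙ(A⋆ = b | Ĥ = h)` after `t` rounds. -/
noncomputable def optProb (P : PartialFeedbackProblem S O A Y) (γ : O → A) (t : ℕ) (b : A)
    (h : Fin t → A × Y) : ℝ≥0∞ :=
  condDistrib Prod.fst Prod.snd (P.thompsonLaw γ t : Measure (O × (Fin t → A × Y))) h (γ ⁻¹' {b})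

/-- The probability `ℙ(A⋆ = b | Ĥ = h, Y_a = y)` for the outcome `Y` of the round that follows the
first `t` ones. -/
noncomputable def optProbGivenOutcome (P : PartialFeedbackProblem S O A Y) (γ : O → A) (t : ℕ)
    (a b : A) (z : (Fin t → A × Y) × Y) : ℝ≥0∞ :=
  condDistrib (fun ω => ω.1.1) (fun ω => (ω.1.2, ω.2 a)) (P.roundLaw γ t) z (γ ⁻¹' {b})

/-- The expected posterior entropy of `A⋆` after `t` rounds. -/
noncomputable def expectedEntropy [Fintype A] (P : PartialFeedbackProblem S O A Y) (γ : O → A)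
    (t : ℕ) : ℝ :=
  ∫ ω, ∑ b, Real.negMulLog (P.optProb γ t b ω.2).toReal
    ∂(P.thompsonLaw γ t : Measure (O × (Fin t → A × Y)))

variable (P : PartialFeedbackProblem S O A Y) (γ : O → A)

lemma thompsonLaw_succ (t : ℕ) :
    (P.thompsonLaw γ (t + 1) : Measure (O × (Fin (t + 1) → A × Y))) =
      ((P.thompsonLaw γ t : Measure (O × (Fin t → A × Y))) ⊗ₘ
        (Kernel.prodMkLeft O (condDistrib Prod.fst Prod.snd
            (P.thompsonLaw γ t : Measure (O × (Fin t → A × Y)))) ×ₖ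
          Kernel.prodMkRight (Fin t → A × Y) P.outcome)).map
      (fun p => (p.1.1, Fin.snoc (α := fun _ => A × Y) p.1.2 (γ p.2.1, p.2.2 (γ p.2.1)))) := rfl

lemma roundLaw_map_fst (t : ℕ) :
    (P.roundLaw γ t).map Prod.fst = (P.thompsonLaw γ t : Measure (O × (Fin t → A × Y))) := by
  rw [roundLaw, ← Measure.fst, Measure.fst_compProd]

end

variable [Fintype A] [DiscreteMeasurableSpace A] {γ : O → A}

lemma measurable_eval_fst : Measurable fun p : A × (A → Y) => p.2 p.1 :=
  measurable_from_prod_countable_right fun a => measurable_pi_apply a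

lemma measurable_step (hγ : Measurable γ) (t : ℕ) :
    Measurable fun p : (O × (Fin t → A × Y)) × (O × (A → Y)) =>
      (p.1.1, Fin.snoc (α := fun _ => A × Y) p.1.2 (γ p.2.1, p.2.2 (γ p.2.1))) := by
  have h1 : Measurable fun p : (O × (Fin t → A × Y)) × (O × (A → Y)) =>
      (γ p.2.1, p.2.2 (γ p.2.1)) :=
    (hγ.comp (by fun_prop)).prodMk
      (measurable_eval_fst.comp ((hγ.comp (by fun_prop)).prodMk (by fun_prop)))
  exact (measurable_fst.comp measurable_fst).prodMk
    ((measurable_finSnoc t).comp ((measurable_snd.comp measurable_fst).prodMk h1))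

lemma sum_real_preimage_singleton (hγ : Measurable γ) (m : Measure O) [IsProbabilityMeasure m] :
    ∑ b, (m (γ ⁻¹' {b})).toReal = 1 := by
  have := sum_measureReal_preimage_singleton (μ := m) (f := γ) Finset.univ
    (fun b _ => hγ (measurableSet_singleton b))
  simpa [Measure.real] using this

variable [StandardBorelSpace O] [Nonempty O] (P : PartialFeedbackProblem S O A Y)

/-- Measurability of γ matters: `Measure.map` along a map that is not a.e. measurable is the zero
measure. -/
lemma isProbabilityMeasure_thompsonLaw (hγ : Measurable γ) (t : ℕ) :
    IsProbabilityMeasure (P.thompsonLaw γ t : Measure (O × (Fin t → A × Y))) := by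
  induction t with
  | zero =>
    change IsProbabilityMeasure (P.prior.map (fun θ => (θ, Fin.elim0)))
    exact Measure.isProbabilityMeasure_map (by fun_prop)
  | succ t ih =>
    rw [thompsonLaw_succ]
    exact Measure.isProbabilityMeasure_map (measurable_step hγ t).aemeasurable

lemma isProbabilityMeasure_roundLaw (hγ : Measurable γ) (t : ℕ) :
    IsProbabilityMeasure (P.roundLaw γ t) := by
  have := P.isProbabilityMeasure_thompsonLaw hγ t
  unfold roundLaw
  infer_instance

lemma isCondProb_optProb_thompsonLaw (hγ : Measurable γ) (t : ℕ) (b : A) :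
    IsCondProb (P.thompsonLaw γ t : Measure (O × (Fin t → A × Y))) (Prod.fst ⁻¹' (γ ⁻¹' {b}))
      Prod.snd (P.optProb γ t b) :=
  isCondProb_condDistrib measurable_fst measurable_snd (hγ (measurableSet_singleton b))

lemma isCondProb_optProb (hγ : Measurable γ) (t : ℕ) (b : A) :
    IsCondProb (P.roundLaw γ t) ((fun ω => γ ω.1.1) ⁻¹' {b}) (fun ω => ω.1.2)
      (P.optProb γ t b) := by
  have h := P.isCondProb_optProb_thompsonLaw hγ t b
  refine ⟨h.measurable, h.le_one, fun f hf => ?_⟩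
  have e := h.setLIntegral_eq f hf
  have hE : MeasurableSet (Prod.fst ⁻¹' (γ ⁻¹' {b}) : Set (O × (Fin t → A × Y))) :=
    measurable_fst (hγ (measurableSet_singleton b))
  have hf' : Measurable fun ω : O × (Fin t → A × Y) => f ω.2 := hf.comp measurable_snd
  have hq' : Measurable fun ω : O × (Fin t → A × Y) => P.optProb γ t b ω.2 :=
    h.measurable.comp measurable_snd
  rw [← P.roundLaw_map_fst, setLIntegral_map hE hf' measurable_fst,
    lintegral_map (hq'.fun_mul hf') measurable_fst] at e
  exact e

lemma isCondProb_optProbGivenOutcome (hγ : Measurable γ) (t : ℕ) (a b : A) :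
    IsCondProb (P.roundLaw γ t) ((fun ω => γ ω.1.1) ⁻¹' {b}) (fun ω => (ω.1.2, ω.2 a))
      (P.optProbGivenOutcome γ t a b) :=
  isCondProb_condDistrib (Θ := fun ω : (O × (Fin t → A × Y)) × (A → Y) => ω.1.1) (by fun_prop)
    (by fun_prop) (hγ (measurableSet_singleton b))

lemma sum_optProb_toReal (hγ : Measurable γ) (t : ℕ) (h : Fin t → A × Y) :
    ∑ b, (P.optProb γ t b h).toReal = 1 :=
  sum_real_preimage_singleton hγ _

lemma sum_optProbGivenOutcome_toReal (hγ : Measurable γ) (t : ℕ) (a : A)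
    (z : (Fin t → A × Y) × Y) : ∑ b, (P.optProbGivenOutcome γ t a b z).toReal = 1 :=
  sum_real_preimage_singleton hγ _

/-- One round of Thompson sampling, as a mixture over the action played. -/
lemma lintegral_thompsonLaw_succ (hγ : Measurable γ) (t : ℕ)
    {F : O × (Fin (t + 1) → A × Y) → ℝ≥0∞} (hF : Measurable F) :
    ∫⁻ ω, F ω ∂(P.thompsonLaw γ (t + 1) : Measure (O × (Fin (t + 1) → A × Y))) =
      ∑ a, ∫⁻ ω, P.optProb γ t a ω.1.2 *
        F (ω.1.1, Fin.snoc (α := fun _ => A × Y) ω.1.2 (a, ω.2 a)) ∂(P.roundLaw γ t) := by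
  have hT : Measurable fun p : (O × (Fin t → A × Y)) × (A × (A → Y)) =>
      F (p.1.1, Fin.snoc (α := fun _ => A × Y) p.1.2 (p.2.1, p.2.2 p.2.1)) :=
    hF.comp ((measurable_fst.comp measurable_fst).prodMk ((measurable_finSnoc t).comp
      ((measurable_snd.comp measurable_fst).prodMk ((measurable_fst.comp measurable_snd).prodMk
        (measurable_eval_fst.comp measurable_snd)))))
  have hTa : ∀ a, Measurable fun ω : (O × (Fin t → A × Y)) × (A → Y) => P.optProb γ t a ω.1.2 *
      F (ω.1.1, Fin.snoc (α := fun _ => A × Y) ω.1.2 (a, ω.2 a)) := fun a =>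
    ((P.isCondProb_optProb hγ t a).measurable.comp (by fun_prop)).mul
      (hT.comp (measurable_fst.prodMk (measurable_const.prodMk measurable_snd)))
  have hm := measurable_step (Y := Y) hγ t
  have hFm : Measurable fun p : (O × (Fin t → A × Y)) × (O × (A → Y)) =>
      F (p.1.1, Fin.snoc (α := fun _ => A × Y) p.1.2 (γ p.2.1, p.2.2 (γ p.2.1))) := hF.comp hm
  rw [thompsonLaw_succ, lintegral_map hF hm, Measure.lintegral_compProd hFm,
    ← lintegral_finsetSum _ fun a _ => hTa a, roundLaw,
    Measure.lintegral_compProd (Finset.measurable_fun_sum _ fun a _ => hTa a)]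
  refine lintegral_congr fun ω => ?_
  rw [Kernel.prod_apply, Kernel.prodMkLeft_apply, Kernel.prodMkRight_apply]
  -- Conditional independence of Θ̂ and the outcome allows Θ̂ to be integrated out first; the image
  -- of the posterior under γ has weights `optProb`.
  refine (lintegral_prod_symm _ (hFm.comp measurable_prodMk_left).aemeasurable).trans ?_
  refine lintegral_congr fun y => ?_
  have hGa : Measurable fun a => F (ω.1, Fin.snoc (α := fun _ => A × Y) ω.2 (a, y a)) :=
    Measurable.of_discrete
  have := lintegral_map (μ := condDistrib Prod.fst Prod.snd
    (P.thompsonLaw γ t : Measure (O × (Fin t → A × Y))) ω.2) hGa hγ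
  refine this.symm.trans ?_
  rw [lintegral_fintype]
  refine Finset.sum_congr rfl fun a _ => ?_
  rw [Measure.map_apply hγ (measurableSet_singleton a), mul_comm]
  rfl

lemma measurable_optProbGivenOutcome_last (hγ : Measurable γ) (t : ℕ) (b : A) :
    Measurable fun h : Fin (t + 1) → A × Y =>
      P.optProbGivenOutcome γ t (h (Fin.last t)).1 b (Fin.init h, (h (Fin.last t)).2) := by
  have h1 : Measurable fun p : A × ((Fin t → A × Y) × Y) =>
      P.optProbGivenOutcome γ t p.1 b p.2 :=
    measurable_from_prod_countable_right fun a =>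
      (P.isCondProb_optProbGivenOutcome hγ t a b).measurable
  have h2 : Measurable fun h : Fin (t + 1) → A × Y => (Fin.init h : Fin t → A × Y) :=
    measurable_pi_lambda _ fun i => measurable_pi_apply _
  exact h1.comp ((measurable_fst.comp (measurable_pi_apply _)).prodMk
    (h2.prodMk (measurable_snd.comp (measurable_pi_apply _))))

/-- Posterior update: after playing `a` and observing `y`, the posterior probability of `A⋆ = b`
is `ℙ(A⋆ = b | Ĥ, Y_a = y)`. -/
lemma optProb_succ_ae_eq (hγ : Measurable γ) (t : ℕ) (b : A) :
    ∀ᵐ ω ∂(P.thompsonLaw γ (t + 1) : Measure (O × (Fin (t + 1) → A × Y))),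
      P.optProb γ (t + 1) b ω.2 = P.optProbGivenOutcome γ t (ω.2 (Fin.last t)).1 b
        (Fin.init ω.2, (ω.2 (Fin.last t)).2) := by
  refine (P.isCondProb_optProb_thompsonLaw hγ (t + 1) b).ae_eq
    (q' := fun h => P.optProbGivenOutcome γ t (h (Fin.last t)).1 b
      (Fin.init h, (h (Fin.last t)).2)) ?_ measurable_snd
  have hm := P.measurable_optProbGivenOutcome_last hγ t b
  refine ⟨hm, fun h => (P.isCondProb_optProbGivenOutcome hγ t _ b).le_one _, fun f hf => ?_⟩
  have hs : MeasurableSet (Prod.fst ⁻¹' (γ ⁻¹' {b}) : Set (O × (Fin (t + 1) → A × Y))) :=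
    measurable_fst (hγ (measurableSet_singleton b))
  have hE : MeasurableSet ((fun ω : (O × (Fin t → A × Y)) × (A → Y) => γ ω.1.1) ⁻¹' {b}) :=
    (hγ.comp (measurable_fst.comp measurable_fst)) (measurableSet_singleton b)
  have hf' : Measurable fun ω : O × (Fin (t + 1) → A × Y) => f ω.2 := hf.comp measurable_snd
  have hm' : Measurable fun ω : O × (Fin (t + 1) → A × Y) => P.optProbGivenOutcome γ t
      (ω.2 (Fin.last t)).1 b (Fin.init ω.2, (ω.2 (Fin.last t)).2) := hm.comp measurable_snd
  rw [← lintegral_indicator hs, P.lintegral_thompsonLaw_succ hγ t (hf'.indicator hs),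
    P.lintegral_thompsonLaw_succ hγ t (hm'.fun_mul hf')]
  refine Finset.sum_congr rfl fun a _ => ?_
  -- For a fixed action, its probability and the extended history are functions of (Ĥ, Y_a), so
  -- their product is an admissible test function for ℙ(A⋆ = b | Ĥ, Y_a).
  have hG : Measurable fun z : (Fin t → A × Y) × Y =>
      P.optProb γ t a z.1 * f (Fin.snoc (α := fun _ => A × Y) z.1 (a, z.2)) :=
    ((P.isCondProb_optProb hγ t a).measurable.comp measurable_fst).mul
      (hf.comp ((measurable_finSnoc t).comp
        (measurable_fst.prodMk (measurable_const.prodMk measurable_snd))))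
  have e := (P.isCondProb_optProbGivenOutcome hγ t a b).setLIntegral_eq _ hG
  rw [← lintegral_indicator hE] at e
  refine Eq.trans ?_ (e.trans ?_) <;> refine lintegral_congr fun ω => ?_
  · by_cases h : γ ω.1.1 = b <;> simp [Set.indicator, h]
  · simp only [Fin.snoc_last, Fin.init_snoc]
    ring

lemma expectedEntropy_zero (hγ : Measurable γ) : P.expectedEntropy γ 0 = P.optEntropy γ := by
  have := P.isProbabilityMeasure_thompsonLaw hγ 0
  -- There is only one empty history, so the posterior is constant and testing against 1 identifies
  -- it.
  have h0 : ∀ (b : A) (h : Fin 0 → A × Y), P.optProb γ 0 b h = P.prior.map γ {b} := by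
    intro b h
    have e := (P.isCondProb_optProb_thompsonLaw hγ 0 b).setLIntegral_eq 1 measurable_one
    have hc : ∀ ω : O × (Fin 0 → A × Y), P.optProb γ 0 b ω.2 * (1 : (Fin 0 → A × Y) → ℝ≥0∞) ω.2
        = P.optProb γ 0 b h := fun ω => by simp [Subsingleton.elim ω.2 h]
    rw [lintegral_congr hc] at e
    simp only [Pi.one_apply, lintegral_const, measure_univ, mul_one, Measure.restrict_apply,
      MeasurableSet.univ, Set.univ_inter, one_mul] at e
    rw [← e, Measure.map_apply hγ (measurableSet_singleton b)]
    change P.prior.map (fun θ => (θ, Fin.elim0)) _ = _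
    rw [Measure.map_apply (by fun_prop) (measurable_fst (hγ (measurableSet_singleton b)))]
    rfl
  simp [expectedEntropy, h0, optEntropy, Measure.real]

lemma expectedEntropy_nonneg (hγ : Measurable γ) (t : ℕ) : 0 ≤ P.expectedEntropy γ t :=
  integral_nonneg fun ω => Finset.sum_nonneg fun b _ =>
    have h := (P.isCondProb_optProb hγ t b).toReal_mem_Icc ω.2
    Real.negMulLog_nonneg h.1 h.2

end

end PartialFeedbackProblem

/-! ### The per-round bounds -/

namespace PartialFeedbackProblem

section

variable {S O A Y : Type*} [MeasurableSpace S] [MeasurableSpace O] [StandardBorelSpace O]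
  [Nonempty O] [MeasurableSpace A] [MeasurableSpace Y]

/-- The random variable `ℙ(A⋆ = b | Ĥ)` after `t` rounds. -/
noncomputable def histProb (P : PartialFeedbackProblem S O A Y) (γ : O → A) (t : ℕ) (b : A)
    (ω : (O × (Fin t → A × Y)) × (A → Y)) : ℝ := (P.optProb γ t b ω.1.2).toReal

/-- The random variable `ℙ(A⋆ = b | Ĥ, Y_a)` after `t` rounds. -/
noncomputable def nextProb (P : PartialFeedbackProblem S O A Y) (γ : O → A) (t : ℕ) (a b : A)
    (ω : (O × (Fin t → A × Y)) × (A → Y)) : ℝ :=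
  (P.optProbGivenOutcome γ t a b (ω.1.2, ω.2 a)).toReal

/-- The expected total variation distance between the laws of `Y_{A⋆}` given `A⋆, Ĥ` and given
`Ĥ`, after `t` rounds. -/
noncomputable def expectedTV [Fintype A] (P : PartialFeedbackProblem S O A Y) (γ : O → A)
    (t : ℕ) : ℝ :=
  ∑ a, ∫ ω, max (P.histProb γ t a ω - P.nextProb γ t a a ω) 0 ∂(P.roundLaw γ t)

variable [Fintype A] [DiscreteMeasurableSpace A] {γ : O → A} (P : PartialFeedbackProblem S O A Y)

lemma histProb_mem_Icc (hγ : Measurable γ) (t : ℕ) (b : A) (ω) :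
    P.histProb γ t b ω ∈ Set.Icc (0 : ℝ) 1 := (P.isCondProb_optProb hγ t b).toReal_mem_Icc _

lemma nextProb_mem_Icc (hγ : Measurable γ) (t : ℕ) (a b : A) (ω) :
    P.nextProb γ t a b ω ∈ Set.Icc (0 : ℝ) 1 :=
  (P.isCondProb_optProbGivenOutcome hγ t a b).toReal_mem_Icc _

lemma measurable_histProb (hγ : Measurable γ) (t : ℕ) (b : A) : Measurable (P.histProb γ t b) :=
  ((P.isCondProb_optProb hγ t b).measurable.comp (measurable_snd.comp measurable_fst)).ennreal_toReal

lemma measurable_nextProb (hγ : Measurable γ) (t : ℕ) (a b : A) :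
    Measurable (P.nextProb γ t a b) :=
  ((P.isCondProb_optProbGivenOutcome hγ t a b).measurable.comp ((measurable_snd.comp
    measurable_fst).prodMk ((measurable_pi_apply a).comp measurable_snd))).ennreal_toReal

lemma sum_histProb (hγ : Measurable γ) (t : ℕ) (ω) : ∑ b, P.histProb γ t b ω = 1 :=
  P.sum_optProb_toReal hγ t _

lemma sum_nextProb (hγ : Measurable γ) (t : ℕ) (a : A) (ω) : ∑ b, P.nextProb γ t a b ω = 1 :=
  P.sum_optProbGivenOutcome_toReal hγ t a _

lemma ae_nextProb_eq_zero (hγ : Measurable γ) (t : ℕ) (a b : A) :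
    ∀ᵐ ω ∂(P.roundLaw γ t), P.histProb γ t b ω = 0 → P.nextProb γ t a b ω = 0 := by
  have hq := P.isCondProb_optProb hγ t b
  filter_upwards [hq.ae_eq_zero_of_eq_zero (P.isCondProb_optProbGivenOutcome hγ t a b)
    (by fun_prop) (by fun_prop) measurable_fst fun _ => rfl] with ω hω h0
  have : P.optProb γ t b ω.1.2 = 0 :=
    ((ENNReal.toReal_eq_zero_iff _).1 h0).resolve_right (hq.ne_top _)
  rw [nextProb, hω this, ENNReal.toReal_zero]

lemma nextProb_mul_integrable_and_integral_eq (hγ : Measurable γ) (t : ℕ) (a b : A)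
    {f : (Fin t → A × Y) → ℝ} (hf : Measurable f)
    (hint : Integrable (fun ω => P.histProb γ t b ω * f ω.1.2) (P.roundLaw γ t)) :
    Integrable (fun ω => P.nextProb γ t a b ω * f ω.1.2) (P.roundLaw γ t) ∧
      ∫ ω, P.nextProb γ t a b ω * f ω.1.2 ∂(P.roundLaw γ t)
        = ∫ ω, P.histProb γ t b ω * f ω.1.2 ∂(P.roundLaw γ t) :=
  (P.isCondProb_optProb hγ t b).integrable_and_integral_eq
    (P.isCondProb_optProbGivenOutcome hγ t a b) (by fun_prop) (by fun_prop) measurable_fst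
    (fun _ => rfl) hf hint

/-! ### Integrability of the entropy terms -/

lemma negMulLog_mem_Icc {x : ℝ} (hx : x ∈ Set.Icc (0 : ℝ) 1) :
    Real.negMulLog x ∈ Set.Icc (0 : ℝ) 1 := by
  refine ⟨Real.negMulLog_nonneg hx.1 hx.2, ?_⟩
  rcases hx.1.eq_or_lt with h | h
  · simp [← h]
  · have := mul_le_mul_of_nonneg_left (Real.one_sub_inv_le_log_of_pos h) hx.1
    rw [mul_sub, mul_inv_cancel₀ h.ne'] at this
    rw [Real.negMulLog]
    linarith

lemma integrable_histProb (hγ : Measurable γ) (t : ℕ) (b : A) :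
    Integrable (P.histProb γ t b) (P.roundLaw γ t) :=
  .of_mem_Icc 0 1 (P.measurable_histProb hγ t b).aemeasurable
    (.of_forall (P.histProb_mem_Icc hγ t b))

lemma integrable_nextProb (hγ : Measurable γ) (t : ℕ) (a b : A) :
    Integrable (P.nextProb γ t a b) (P.roundLaw γ t) :=
  .of_mem_Icc 0 1 (P.measurable_nextProb hγ t a b).aemeasurable
    (.of_forall (P.nextProb_mem_Icc hγ t a b))

lemma integrable_negMulLog_histProb (hγ : Measurable γ) (t : ℕ) (b : A) :
    Integrable (fun ω => Real.negMulLog (P.histProb γ t b ω)) (P.roundLaw γ t) :=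
  .of_mem_Icc 0 1 (Real.continuous_negMulLog.measurable.comp
    (P.measurable_histProb hγ t b)).aemeasurable
    (.of_forall fun ω => negMulLog_mem_Icc (P.histProb_mem_Icc hγ t b ω))

lemma integrable_negMulLog_nextProb (hγ : Measurable γ) (t : ℕ) (a b : A) :
    Integrable (fun ω => Real.negMulLog (P.nextProb γ t a b ω)) (P.roundLaw γ t) :=
  .of_mem_Icc 0 1 (Real.continuous_negMulLog.measurable.comp
    (P.measurable_nextProb hγ t a b)).aemeasurable
    (.of_forall fun ω => negMulLog_mem_Icc (P.nextProb_mem_Icc hγ t a b ω))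

lemma integrable_histProb_mul (hγ : Measurable γ) (t : ℕ) (a : A)
    {f : (O × (Fin t → A × Y)) × (A → Y) → ℝ} (hf : Integrable f (P.roundLaw γ t)) :
    Integrable (fun ω => P.histProb γ t a ω * f ω) (P.roundLaw γ t) :=
  hf.bdd_mul (c := 1) (P.measurable_histProb hγ t a).aestronglyMeasurable
    (.of_forall fun ω => by
      have h := P.histProb_mem_Icc hγ t a ω
      rw [Real.norm_of_nonneg h.1]; exact h.2)

lemma integral_nextProb (hγ : Measurable γ) (t : ℕ) (a b : A) :
    ∫ ω, P.nextProb γ t a b ω ∂(P.roundLaw γ t) = ∫ ω, P.histProb γ t b ω ∂(P.roundLaw γ t) := by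
  simpa using (P.nextProb_mul_integrable_and_integral_eq hγ t a b (f := fun _ => 1)
    measurable_const (by simpa using P.integrable_histProb hγ t b)).2

lemma measurable_log_optProb (hγ : Measurable γ) (t : ℕ) (b : A) :
    Measurable fun h => Real.log (P.optProb γ t b h).toReal :=
  Real.measurable_log.comp (P.isCondProb_optProb hγ t b).measurable.ennreal_toReal

/-- The logarithm is unbounded, but the tower property replaces `nextProb` by `histProb`, and p log
p is bounded. -/
lemma integrable_nextProb_mul_log (hγ : Measurable γ) (t : ℕ) (a b : A) :
    Integrable (fun ω => P.nextProb γ t a b ω * Real.log (P.histProb γ t b ω))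
      (P.roundLaw γ t) := by
  refine (P.nextProb_mul_integrable_and_integral_eq hγ t a b
    (P.measurable_log_optProb hγ t b) ?_).1
  refine (P.integrable_negMulLog_histProb hγ t b).neg.congr (.of_forall fun ω => ?_)
  simp [Real.negMulLog, histProb]

lemma integrable_relEntropyTerm (hγ : Measurable γ) (t : ℕ) (a b : A) :
    Integrable (fun ω => relEntropyTerm (P.nextProb γ t a b ω) (P.histProb γ t b ω))
      (P.roundLaw γ t) := by
  refine ((((P.integrable_negMulLog_nextProb hγ t a b).neg.sub
    (P.integrable_nextProb_mul_log hγ t a b)).sub (P.integrable_nextProb hγ t a b)).add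
    (P.integrable_histProb hγ t b)).congr (.of_forall fun ω => ?_)
  simp [relEntropyTerm, Real.negMulLog]

/-! ### Entropy drop as information gain -/

lemma expectedEntropy_eq (hγ : Measurable γ) (t : ℕ) :
    P.expectedEntropy γ t
      = ∫ ω, ∑ b, Real.negMulLog (P.histProb γ t b ω) ∂(P.roundLaw γ t) := by
  have hm : Measurable fun ω : O × (Fin t → A × Y) =>
      ∑ b, Real.negMulLog (P.optProb γ t b ω.2).toReal :=
    Finset.measurable_fun_sum _ fun b _ => Real.continuous_negMulLog.measurable.comp
      ((P.isCondProb_optProb hγ t b).measurable.comp measurable_snd).ennreal_toReal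
  rw [expectedEntropy, ← P.roundLaw_map_fst,
    integral_map measurable_fst.aemeasurable hm.aestronglyMeasurable]
  rfl

/-- Action a is played with conditional probability `histProb` a, and the posterior then becomes
`nextProb` a. -/
lemma expectedEntropy_succ (hγ : Measurable γ) (t : ℕ) :
    P.expectedEntropy γ (t + 1) = ∑ a, ∫ ω, P.histProb γ t a ω *
      ∑ b, Real.negMulLog (P.nextProb γ t a b ω) ∂(P.roundLaw γ t) := by
  set G : O × (Fin (t + 1) → A × Y) → ℝ := fun ω => ∑ b, Real.negMulLog
    (P.optProbGivenOutcome γ t (ω.2 (Fin.last t)).1 b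
      (Fin.init ω.2, (ω.2 (Fin.last t)).2)).toReal with hG
  have hGm : Measurable G := Finset.measurable_fun_sum _ fun b _ =>
    Real.continuous_negMulLog.measurable.comp
      ((P.measurable_optProbGivenOutcome_last hγ t b).comp measurable_snd).ennreal_toReal
  have hG0 : ∀ ω, 0 ≤ G ω := fun ω => Finset.sum_nonneg fun b _ =>
    (negMulLog_mem_Icc ((P.isCondProb_optProbGivenOutcome hγ t _ b).toReal_mem_Icc _)).1
  have h0 : ∀ a ω, 0 ≤ P.histProb γ t a ω * ∑ b, Real.negMulLog (P.nextProb γ t a b ω) :=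
    fun a ω => mul_nonneg (P.histProb_mem_Icc hγ t a ω).1
      (Finset.sum_nonneg fun b _ => (negMulLog_mem_Icc (P.nextProb_mem_Icc hγ t a b ω)).1)
  have hi : ∀ a, Integrable (fun ω => P.histProb γ t a ω *
      ∑ b, Real.negMulLog (P.nextProb γ t a b ω)) (P.roundLaw γ t) := fun a =>
    P.integrable_histProb_mul hγ t a
      (integrable_finsetSum _ fun b _ => P.integrable_negMulLog_nextProb hγ t a b)
  have hae : ∀ᵐ ω ∂(P.thompsonLaw γ (t + 1) : Measure (O × (Fin (t + 1) → A × Y))),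
      ∑ b, Real.negMulLog (P.optProb γ (t + 1) b ω.2).toReal = G ω := by
    filter_upwards [ae_all_iff.2 fun b => P.optProb_succ_ae_eq hγ t b] with ω hω
    simp only [hω, hG]
  rw [expectedEntropy, integral_congr_ae hae,
    integral_eq_lintegral_of_nonneg_ae (.of_forall hG0) hGm.aestronglyMeasurable,
    P.lintegral_thompsonLaw_succ hγ t hGm.ennreal_ofReal]
  have e : ∀ a, ∫⁻ ω, P.optProb γ t a ω.1.2 * ENNReal.ofReal
        (G (ω.1.1, Fin.snoc (α := fun _ => A × Y) ω.1.2 (a, ω.2 a))) ∂(P.roundLaw γ t)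
      = ENNReal.ofReal (∫ ω, P.histProb γ t a ω *
        ∑ b, Real.negMulLog (P.nextProb γ t a b ω) ∂(P.roundLaw γ t)) := by
    intro a
    rw [ofReal_integral_eq_lintegral_ofReal (hi a) (.of_forall (h0 a))]
    refine lintegral_congr fun ω => ?_
    rw [ENNReal.ofReal_mul (P.histProb_mem_Icc hγ t a ω).1, histProb,
      ENNReal.ofReal_toReal ((P.isCondProb_optProb hγ t a).ne_top _)]
    simp [hG, nextProb]
  simp only [e]
  rw [← ENNReal.ofReal_sum_of_nonneg fun a _ => integral_nonneg (h0 a),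
    ENNReal.toReal_ofReal (Finset.sum_nonneg fun a _ => integral_nonneg (h0 a))]

/-- The expected information gain about `A⋆` in one round is the decrease of the expected posterior
entropy. -/
lemma sum_integral_relEntropyTerm (hγ : Measurable γ) (t : ℕ) :
    ∑ a, ∑ b, ∫ ω, P.histProb γ t a ω * relEntropyTerm (P.nextProb γ t a b ω)
        (P.histProb γ t b ω) ∂(P.roundLaw γ t)
      = P.expectedEntropy γ t - P.expectedEntropy γ (t + 1) := by
  have i1 : ∀ a, Integrable (fun ω => P.histProb γ t a ω *
      ∑ b, Real.negMulLog (P.nextProb γ t a b ω)) (P.roundLaw γ t) := fun a =>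
    P.integrable_histProb_mul hγ t a
      (integrable_finsetSum _ fun b _ => P.integrable_negMulLog_nextProb hγ t a b)
  have i2 : ∀ a b, Integrable (fun ω => P.histProb γ t a ω *
      (P.nextProb γ t a b ω * Real.log (P.histProb γ t b ω))) (P.roundLaw γ t) := fun a b =>
    P.integrable_histProb_mul hγ t a (P.integrable_nextProb_mul_log hγ t a b)
  have i3 : ∀ a b, Integrable (fun ω => P.histProb γ t a ω *
      Real.negMulLog (P.histProb γ t b ω)) (P.roundLaw γ t) := fun a b =>
    P.integrable_histProb_mul hγ t a (P.integrable_negMulLog_histProb hγ t b)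
  -- Since p_a log p_b depends on the history only, the tower property turns the cross-entropy into
  -- an entropy.
  have e2 : ∀ a b, ∫ ω, P.histProb γ t a ω *
      (P.nextProb γ t a b ω * Real.log (P.histProb γ t b ω)) ∂(P.roundLaw γ t)
      = - ∫ ω, P.histProb γ t a ω * Real.negMulLog (P.histProb γ t b ω) ∂(P.roundLaw γ t) := by
    intro a b
    have hf : Measurable fun h => (P.optProb γ t a h).toReal *
        Real.log (P.optProb γ t b h).toReal :=
      (P.isCondProb_optProb hγ t a).measurable.ennreal_toReal.mul
        (P.measurable_log_optProb hγ t b)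
    have hc : ∀ ω, P.histProb γ t b ω * ((P.optProb γ t a ω.1.2).toReal *
        Real.log (P.optProb γ t b ω.1.2).toReal)
        = -(P.histProb γ t a ω * Real.negMulLog (P.histProb γ t b ω)) := fun ω => by
      simp only [Real.negMulLog, histProb]; ring
    have := (P.nextProb_mul_integrable_and_integral_eq hγ t a b hf
      ((i3 a b).neg.congr (.of_forall fun ω => (hc ω).symm))).2
    rw [integral_congr_ae (.of_forall hc), integral_neg] at this
    rw [← this]
    refine integral_congr_ae (.of_forall fun ω => ?_)
    simp only [histProb]; ring
  have e1 : ∀ a, ∑ b, ∫ ω, P.histProb γ t a ω * relEntropyTerm (P.nextProb γ t a b ω)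
        (P.histProb γ t b ω) ∂(P.roundLaw γ t)
      = ∑ b, ∫ ω, P.histProb γ t a ω * Real.negMulLog (P.histProb γ t b ω) ∂(P.roundLaw γ t)
        - ∫ ω, P.histProb γ t a ω *
          ∑ b, Real.negMulLog (P.nextProb γ t a b ω) ∂(P.roundLaw γ t) := by
    intro a
    rw [← integral_finsetSum _ fun b _ =>
      P.integrable_histProb_mul hγ t a (P.integrable_relEntropyTerm hγ t a b)]
    have hpt : ∀ ω, ∑ b, P.histProb γ t a ω * relEntropyTerm (P.nextProb γ t a b ω)
          (P.histProb γ t b ω)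
        = -(∑ b, P.histProb γ t a ω *
            (P.nextProb γ t a b ω * Real.log (P.histProb γ t b ω)))
          - P.histProb γ t a ω * ∑ b, Real.negMulLog (P.nextProb γ t a b ω) := by
      intro ω
      -- The linear parts −x + p cancel, as both families sum to one.
      have hs : ∑ b, relEntropyTerm (P.nextProb γ t a b ω) (P.histProb γ t b ω)
          = -(∑ b, Real.negMulLog (P.nextProb γ t a b ω))
            - ∑ b, P.nextProb γ t a b ω * Real.log (P.histProb γ t b ω) := by
        simp only [relEntropyTerm, Finset.sum_add_distrib, Finset.sum_sub_distrib,
          P.sum_histProb hγ, P.sum_nextProb hγ, Real.negMulLog, neg_mul, Finset.sum_neg_distrib]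
        ring
      rw [← Finset.mul_sum, ← Finset.mul_sum, hs]
      ring
    have i2' : Integrable (fun ω => -(∑ b, P.histProb γ t a ω *
        (P.nextProb γ t a b ω * Real.log (P.histProb γ t b ω)))) (P.roundLaw γ t) :=
      (integrable_finsetSum _ fun b _ => i2 a b).neg
    rw [integral_congr_ae (.of_forall hpt), integral_sub i2' (i1 a), integral_neg,
      integral_finsetSum _ fun b _ => i2 a b]
    simp only [e2, Finset.sum_neg_distrib, neg_neg]
  simp only [e1, Finset.sum_sub_distrib]
  rw [P.expectedEntropy_succ hγ t, P.expectedEntropy_eq hγ t,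
    integral_finsetSum _ fun b _ => P.integrable_negMulLog_histProb hγ t b, Finset.sum_comm]
  congr 1
  refine Finset.sum_congr rfl fun b _ => ?_
  rw [← integral_finsetSum _ fun a _ => i3 a b]
  refine integral_congr_ae (.of_forall fun ω => ?_)
  simp only [← Finset.sum_mul, P.sum_histProb hγ, one_mul]

end

end PartialFeedbackProblem

/-! ### Total variation against information gain -/

namespace PartialFeedbackProblem

section

variable {S O A Y : Type*} [MeasurableSpace S] [MeasurableSpace O] [StandardBorelSpace O]
  [Nonempty O] [MeasurableSpace A] [MeasurableSpace Y] [Fintype A] [DiscreteMeasurableSpace A]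
  {γ : O → A} (P : PartialFeedbackProblem S O A Y)

lemma integrable_max_histProb_sub_nextProb (hγ : Measurable γ) (t : ℕ) (a : A) :
    Integrable (fun ω => max (P.histProb γ t a ω - P.nextProb γ t a a ω) 0) (P.roundLaw γ t) :=
  ((P.integrable_histProb hγ t a).sub (P.integrable_nextProb hγ t a a)).pos_part

lemma integral_histProb_mul_relEntropyTerm_nonneg (hγ : Measurable γ) (t : ℕ) (a b c : A) :
    0 ≤ ∫ ω, P.histProb γ t c ω * relEntropyTerm (P.nextProb γ t a b ω) (P.histProb γ t b ω)
      ∂(P.roundLaw γ t) := by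
  refine integral_nonneg_of_ae ?_
  filter_upwards [P.ae_nextProb_eq_zero hγ t a b] with ω hω
  exact mul_nonneg (P.histProb_mem_Icc hγ t c ω).1
    (relEntropyTerm_nonneg (P.nextProb_mem_Icc hγ t a b ω).1 (P.histProb_mem_Icc hγ t b ω).1 hω)

/-- The information ratio bound: one round of Thompson sampling gains information about `A⋆`
in proportion to the squared expected total variation. -/
lemma expectedTV_le (hγ : Measurable γ) (t : ℕ) {l : ℝ} (hl : 0 < l) :
    P.expectedTV γ t ≤ l / 2 * (P.expectedEntropy γ t - P.expectedEntropy γ (t + 1))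
      + 1 / 2 * (Fintype.card A : ℝ) / (2 * l) := by
  have := P.isProbabilityMeasure_roundLaw hγ t
  have key : ∀ a, ∫ ω, max (P.histProb γ t a ω - P.nextProb γ t a a ω) 0 ∂(P.roundLaw γ t)
      ≤ l / 2 * ∫ ω, P.histProb γ t a ω * relEntropyTerm (P.nextProb γ t a a ω)
          (P.histProb γ t a ω) ∂(P.roundLaw γ t) + 1 / 2 * 1 / (2 * l) := by
    intro a
    have ip := P.integrable_histProb hγ t a
    have ix := P.integrable_nextProb hγ t a a
    have iD := P.integrable_histProb_mul hγ t a (P.integrable_relEntropyTerm hγ t a a)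
    -- With 0⁻¹ = 0 the product p·p⁻¹ is the indicator of p ≠ 0.
    have hu : ∀ ω, P.histProb γ t a ω * (P.histProb γ t a ω)⁻¹ ∈ Set.Icc (0 : ℝ) 1 := fun ω =>
      ⟨mul_nonneg (P.histProb_mem_Icc hγ t a ω).1
        (inv_nonneg.2 (P.histProb_mem_Icc hγ t a ω).1), mul_inv_le_one⟩
    have iu : Integrable (fun ω => P.histProb γ t a ω * (P.histProb γ t a ω)⁻¹)
        (P.roundLaw γ t) :=
      .of_mem_Icc 0 1 ((P.measurable_histProb hγ t a).mul
        (P.measurable_histProb hγ t a).inv).aemeasurable (.of_forall hu)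
    obtain ⟨iv, ev⟩ := P.nextProb_mul_integrable_and_integral_eq hγ t a a
      (f := fun h => (P.optProb γ t a h).toReal⁻¹)
      (P.isCondProb_optProb hγ t a).measurable.ennreal_toReal.inv iu
    change Integrable (fun ω => P.nextProb γ t a a ω * (P.histProb γ t a ω)⁻¹) _ at iv
    change ∫ ω, P.nextProb γ t a a ω * (P.histProb γ t a ω)⁻¹ ∂_
      = ∫ ω, P.histProb γ t a ω * (P.histProb γ t a ω)⁻¹ ∂_ at ev
    have hu1 : ∫ ω, P.histProb γ t a ω * (P.histProb γ t a ω)⁻¹ ∂(P.roundLaw γ t) ≤ 1 := by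
      simpa using integral_mono iu (integrable_const (1 : ℝ)) fun ω => (hu ω).2
    have i1 : Integrable (fun ω => (P.histProb γ t a ω - P.nextProb γ t a a ω) / 2)
        (P.roundLaw γ t) := (ip.sub ix).div_const 2
    have i2 : Integrable (fun ω => l / 2 * (P.histProb γ t a ω *
        relEntropyTerm (P.nextProb γ t a a ω) (P.histProb γ t a ω))) (P.roundLaw γ t) :=
      iD.const_mul _
    have i3 : Integrable (fun ω => (P.nextProb γ t a a ω * (P.histProb γ t a ω)⁻¹
        + 2 * (P.histProb γ t a ω * (P.histProb γ t a ω)⁻¹)) / (12 * l)) (P.roundLaw γ t) :=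
      (iv.add (iu.const_mul 2)).div_const _
    calc ∫ ω, max (P.histProb γ t a ω - P.nextProb γ t a a ω) 0 ∂(P.roundLaw γ t)
        ≤ ∫ ω, ((P.histProb γ t a ω - P.nextProb γ t a a ω) / 2
            + l / 2 * (P.histProb γ t a ω *
              relEntropyTerm (P.nextProb γ t a a ω) (P.histProb γ t a ω))
            + (P.nextProb γ t a a ω * (P.histProb γ t a ω)⁻¹
              + 2 * (P.histProb γ t a ω * (P.histProb γ t a ω)⁻¹)) / (12 * l))
            ∂(P.roundLaw γ t) := by
          refine integral_mono_ae (P.integrable_max_histProb_sub_nextProb hγ t a)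
            ((i1.add i2).add i3) ?_
          filter_upwards [P.ae_nextProb_eq_zero hγ t a a] with ω hω
          have hp := (P.histProb_mem_Icc hγ t a ω).1
          have hx := (P.nextProb_mem_Icc hγ t a a ω).1
          rcases hp.eq_or_lt with h0 | hp
          · simp [← h0, hω h0.symm]
          -- The parameter l·p weights D by the probability of playing a; the remainder (x +
          -- 2p)/(12lp) has expectation at most 3/(12l).
          · refine (max_sub_le_relEntropyTerm hx hp.le hω (mul_pos hl hp)).trans_eq ?_
            field_simp
      _ = l / 2 * ∫ ω, P.histProb γ t a ω * relEntropyTerm (P.nextProb γ t a a ω)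
            (P.histProb γ t a ω) ∂(P.roundLaw γ t)
          + 3 * (∫ ω, P.histProb γ t a ω * (P.histProb γ t a ω)⁻¹ ∂(P.roundLaw γ t))
            / (12 * l) := by
          have i12 := i1.add i2
          simp only [Pi.add_def] at i12
          rw [integral_add i12 i3, integral_add i1 i2, integral_div, integral_sub ip ix,
            P.integral_nextProb hγ t a a, integral_const_mul, integral_div,
            integral_add iv (iu.const_mul 2), integral_const_mul, ev]
          ring
      _ ≤ _ := by
          have : 3 * (∫ ω, P.histProb γ t a ω * (P.histProb γ t a ω)⁻¹ ∂(P.roundLaw γ t))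
              / (12 * l) ≤ 3 * 1 / (12 * l) := by gcongr
          have e : 3 * 1 / (12 * l) = 1 / 2 * 1 / (2 * l) := by field_simp; norm_num
          linarith
  rw [← P.sum_integral_relEntropyTerm hγ t]
  calc P.expectedTV γ t ≤ ∑ a, (l / 2 * ∫ ω, P.histProb γ t a ω *
        relEntropyTerm (P.nextProb γ t a a ω) (P.histProb γ t a ω) ∂(P.roundLaw γ t)
          + 1 / 2 * 1 / (2 * l)) := Finset.sum_le_sum fun a _ => key a
    _ = l / 2 * ∑ a, ∫ ω, P.histProb γ t a ω *
        relEntropyTerm (P.nextProb γ t a a ω) (P.histProb γ t a ω) ∂(P.roundLaw γ t)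
          + 1 / 2 * (Fintype.card A : ℝ) / (2 * l) := by
        rw [Finset.sum_add_distrib, ← Finset.mul_sum, Finset.sum_const, Finset.card_univ,
          nsmul_eq_mul]
        ring
    _ ≤ _ := by
        -- Only the diagonal terms b = a were used; the other terms of the gain are nonnegative.
        gcongr with a
        exact Finset.single_le_sum (f := fun b => ∫ ω, P.histProb γ t a ω *
          relEntropyTerm (P.nextProb γ t a b ω) (P.histProb γ t b ω) ∂(P.roundLaw γ t))
          (fun b _ => P.integral_histProb_mul_relEntropyTerm_nonneg hγ t a b a)
          (Finset.mem_univ a)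

/-- Revelation is assumed for almost every parameter under the prior, and Θ keeps the prior as its
marginal law in every round. -/
lemma ae_eq_of_perfectlyRevealed {a : A} {f : Y → A → Y} (hf : Measurable f)
    (h : ∀ᵐ θ ∂P.prior, ∀ᵐ y ∂(P.outcome θ), f (y a) = y) (hγ : Measurable γ) (t : ℕ)
    [StandardBorelSpace Y] :
    ∀ᵐ ω ∂(P.roundLaw γ t), f (ω.2 a) = ω.2 := by
  have hmap : ∀ t, (P.thompsonLaw γ t : Measure (O × (Fin t → A × Y))).map Prod.fst
      = P.prior := by
    intro t
    induction t with
    | zero =>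
      change (P.prior.map (fun θ => (θ, Fin.elim0))).map Prod.fst = _
      rw [Measure.map_map measurable_fst (by fun_prop)]
      exact Measure.map_id
    | succ t ih =>
      rw [thompsonLaw_succ, Measure.map_map measurable_fst (measurable_step hγ t)]
      change Measure.map (Prod.fst ∘ Prod.fst) _ = _
      rw [← Measure.map_map measurable_fst measurable_fst]
      change Measure.map Prod.fst (Measure.fst _) = _
      rw [Measure.fst_compProd, ih]
  have hs : MeasurableSet {y : A → Y | f (y a) = y} :=
    measurableSet_eq_fun (hf.comp (measurable_pi_apply a)) measurable_id
  have hs' : MeasurableSet {ω : (O × (Fin t → A × Y)) × (A → Y) | f (ω.2 a) = ω.2} :=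
    measurable_snd hs
  rw [roundLaw, Measure.ae_compProd_iff hs']
  rw [← hmap t] at h
  exact ae_of_ae_map measurable_fst.aemeasurable h

/-- If every component reveals the outcome vector, then the posterior update does not depend on
the component observed. -/
lemma nextProb_ae_eq_of_perfectlyRevealed [StandardBorelSpace Y] (hP : P.PerfectlyRevealed)
    (hγ : Measurable γ) (t : ℕ) (a c b : A) :
    ∀ᵐ ω ∂(P.roundLaw γ t), P.nextProb γ t a b ω = P.nextProb γ t c b ω := by
  -- Since Y = f(Y_a) a.s., conditioning on Y_a amounts to conditioning on all of Y; uniqueness of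
  -- versions then compares two actions.
  have full : ∀ a, IsCondProb (P.roundLaw γ t) ((fun ω => γ ω.1.1) ⁻¹' {b})
      (fun ω => (ω.1.2, ω.2)) (fun z => P.optProbGivenOutcome γ t a b (z.1, z.2 a)) := by
    intro a
    have h := P.isCondProb_optProbGivenOutcome hγ t a b
    obtain ⟨f, hf, hfa⟩ := hP a
    have hae := P.ae_eq_of_perfectlyRevealed hf hfa hγ t
    refine ⟨h.measurable.comp (by fun_prop), fun z => h.le_one _, fun F hF => ?_⟩
    have e := h.setLIntegral_eq (fun z => F (z.1, f z.2)) (hF.comp (by fun_prop))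
    refine Eq.trans ?_ (e.trans ?_)
    · refine lintegral_congr_ae (ae_restrict_of_ae ?_)
      filter_upwards [hae] with ω hω
      rw [hω]
    · refine lintegral_congr_ae ?_
      filter_upwards [hae] with ω hω
      rw [hω]
  filter_upwards [(full a).ae_eq (full c) (by fun_prop)] with ω hω
  exact congrArg ENNReal.toReal hω

lemma expectedTV_le_of_perfectlyRevealed [StandardBorelSpace Y] (hP : P.PerfectlyRevealed)
    (hγ : Measurable γ) (t : ℕ) {l : ℝ} (hl : 0 < l) :
    P.expectedTV γ t ≤ l / 2 * (P.expectedEntropy γ t - P.expectedEntropy γ (t + 1))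
      + 1 / 2 / (2 * l) := by
  have := P.isProbabilityMeasure_roundLaw hγ t
  have key : ∀ a, ∫ ω, max (P.histProb γ t a ω - P.nextProb γ t a a ω) 0 ∂(P.roundLaw γ t)
      ≤ l / 2 * ∫ ω, relEntropyTerm (P.nextProb γ t a a ω) (P.histProb γ t a ω) ∂(P.roundLaw γ t)
        + 1 / 2 / (2 * l) * ∫ ω, P.histProb γ t a ω ∂(P.roundLaw γ t) := by
    intro a
    have ip := P.integrable_histProb hγ t a
    have ix := P.integrable_nextProb hγ t a a
    have i1 : Integrable (fun ω => (P.histProb γ t a ω - P.nextProb γ t a a ω) / 2)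
        (P.roundLaw γ t) := (ip.sub ix).div_const 2
    have i2 := (P.integrable_relEntropyTerm hγ t a a).const_mul (l / 2)
    have i3 : Integrable (fun ω => (P.nextProb γ t a a ω + 2 * P.histProb γ t a ω) / (12 * l))
        (P.roundLaw γ t) := (ix.add (ip.const_mul 2)).div_const _
    calc ∫ ω, max (P.histProb γ t a ω - P.nextProb γ t a a ω) 0 ∂(P.roundLaw γ t)
        ≤ ∫ ω, ((P.histProb γ t a ω - P.nextProb γ t a a ω) / 2
            + l / 2 * relEntropyTerm (P.nextProb γ t a a ω) (P.histProb γ t a ω)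
            + (P.nextProb γ t a a ω + 2 * P.histProb γ t a ω) / (12 * l)) ∂(P.roundLaw γ t) := by
          refine integral_mono_ae (P.integrable_max_histProb_sub_nextProb hγ t a)
            ((i1.add i2).add i3) ?_
          filter_upwards [P.ae_nextProb_eq_zero hγ t a a] with ω hω
          exact max_sub_le_relEntropyTerm (P.nextProb_mem_Icc hγ t a a ω).1
            (P.histProb_mem_Icc hγ t a ω).1 hω hl
      _ = _ := by
          have i12 := i1.add i2
          simp only [Pi.add_def] at i12
          rw [integral_add i12 i3, integral_add i1 i2, integral_div, integral_sub ip ix,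
            P.integral_nextProb hγ t a a, integral_const_mul, integral_div,
            integral_add ix (ip.const_mul 2), integral_const_mul, P.integral_nextProb hγ t a a]
          field_simp
          ring
  -- The observed component can be changed to b at no cost, after which the weights p_a sum to one:
  -- the diagonal alone carries the whole gain.
  have hgain : ∑ b, ∫ ω, relEntropyTerm (P.nextProb γ t b b ω) (P.histProb γ t b ω)
      ∂(P.roundLaw γ t) = P.expectedEntropy γ t - P.expectedEntropy γ (t + 1) := by
    rw [← P.sum_integral_relEntropyTerm hγ t, Finset.sum_comm]
    refine Finset.sum_congr rfl fun b _ => ?_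
    rw [← integral_finsetSum _ fun a _ =>
      P.integrable_histProb_mul hγ t a (P.integrable_relEntropyTerm hγ t a b)]
    refine integral_congr_ae ?_
    filter_upwards [ae_all_iff.2 fun a => P.nextProb_ae_eq_of_perfectlyRevealed hP hγ t a b b]
      with ω hω
    simp only [hω, ← Finset.sum_mul, P.sum_histProb hγ, one_mul]
  have hsum : ∑ a, ∫ ω, P.histProb γ t a ω ∂(P.roundLaw γ t) = 1 := by
    rw [← integral_finsetSum _ fun a _ => P.integrable_histProb hγ t a]
    simp [P.sum_histProb hγ]
  calc P.expectedTV γ t ≤ _ := Finset.sum_le_sum fun a _ => key a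
    _ = _ := by
      rw [Finset.sum_add_distrib, ← Finset.mul_sum, ← Finset.mul_sum, hgain, hsum, mul_one]

/-! ### From total variation to the Wasserstein bound, and summation over rounds -/

/-- The expected discrete Wasserstein distance is bounded by the expected total variation. -/
lemma lintegral_wassersteinOne_le_expectedTV [StandardBorelSpace Y] [Nonempty Y]
    (hγ : Measurable γ) (t : ℕ) :
    ∫⁻ ω, wassersteinOne discreteMetric (P.outcomeGivenOptHist γ t (γ ω.1) (γ ω.1) ω.2)
        (P.outcomeGivenHist γ t (γ ω.1) ω.2)
        ∂(P.thompsonLaw γ t : Measure (O × (Fin t → A × Y)))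
      ≤ ENNReal.ofReal (P.expectedTV γ t) := by
  set B : (O × (Fin t → A × Y)) × (A → Y) → A := fun ω => γ ω.1.1 with hB_def
  have hB : Measurable B := hγ.comp (measurable_fst.comp measurable_fst)
  have hcover : (⋃ a, B ⁻¹' {a}) = Set.univ := by
    rw [← Set.preimage_iUnion, Set.iUnion_of_singleton, Set.preimage_univ]
  have hterm : ∀ a, ∫⁻ ω in B ⁻¹' {a}, wassersteinOne discreteMetric
      (P.outcomeGivenOptHist γ t (B ω) (B ω) ω.1.2) (P.outcomeGivenHist γ t (B ω) ω.1.2)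
        ∂(P.roundLaw γ t)
      ≤ ENNReal.ofReal (∫ ω, max (P.histProb γ t a ω - P.nextProb γ t a a ω) 0
        ∂(P.roundLaw γ t)) := by
    intro a
    have hq := P.isCondProb_optProb hγ t a
    have hg := P.isCondProb_optProbGivenOutcome hγ t a a
    rw [ofReal_integral_eq_lintegral_ofReal (P.integrable_max_histProb_sub_nextProb hγ t a)
      (.of_forall fun ω => le_max_right _ _)]
    calc _ = ∫⁻ ω in B ⁻¹' {a}, wassersteinOne discreteMetric
            (P.outcomeGivenOptHist γ t a a ω.1.2) (P.outcomeGivenHist γ t a ω.1.2)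
            ∂(P.roundLaw γ t) :=
          setLIntegral_congr_fun (hB (measurableSet_singleton a)) fun ω hω => by
            have : B ω = a := hω
            simp only [this]
      _ ≤ ∫⁻ ω, (P.optProb γ t a ω.1.2 - P.optProbGivenOutcome γ t a a (ω.1.2, ω.2 a))
            ∂(P.roundLaw γ t) :=
          setLIntegral_wassersteinOne_le hB (H := fun ω => ω.1.2) (by fun_prop) (by fun_prop) hq hg
      _ = _ := by
          refine lintegral_congr fun ω => ?_
          rw [ENNReal.ofReal_max, ENNReal.ofReal_zero, max_eq_left zero_le, histProb, nextProb,
            ENNReal.ofReal_sub _ ENNReal.toReal_nonneg, ENNReal.ofReal_toReal (hq.ne_top _),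
            ENNReal.ofReal_toReal (hg.ne_top _)]
  have h0 : ∀ a, 0 ≤ ∫ ω, max (P.histProb γ t a ω - P.nextProb γ t a a ω) 0
      ∂(P.roundLaw γ t) := fun a => integral_nonneg fun ω => le_max_right _ _
  rw [← P.roundLaw_map_fst]
  refine (lintegral_map_le _ _).trans ?_
  -- Splitting by the value of A⋆ freezes the component index.
  rw [← setLIntegral_univ, ← hcover, lintegral_iUnion
    (fun a => hB (measurableSet_singleton a)) (fun a b hab => Disjoint.preimage _ (by simpa)),
    tsum_fintype, expectedTV, ENNReal.ofReal_sum_of_nonneg fun a _ => h0 a]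
  exact Finset.sum_le_sum fun a _ => hterm a

/-- The hypothesis is linear in the entropy drop, so for a common l the rounds telescope; l is
optimized once, after summation. -/
lemma wassersteinBound_le_sqrt [StandardBorelSpace Y] [Nonempty Y] (hγ : Measurable γ) (T : ℕ)
    {C : ℝ} (hC : 0 ≤ C)
    (h : ∀ t, ∀ l : ℝ, 0 < l → P.expectedTV γ t ≤
      l / 2 * (P.expectedEntropy γ t - P.expectedEntropy γ (t + 1)) + C / (2 * l)) :
    P.wassersteinBound γ T ≤ ENNReal.ofReal (Real.sqrt (C * P.optEntropy γ * (T : ℝ))) := by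
  have h0 : ∀ t, 0 ≤ P.expectedTV γ t := fun t =>
    Finset.sum_nonneg fun a _ => integral_nonneg fun ω => le_max_right _ _
  have hH : 0 ≤ P.optEntropy γ := by
    rw [← P.expectedEntropy_zero hγ]; exact P.expectedEntropy_nonneg hγ 0
  have hreal : ∑ t ∈ Finset.range T, P.expectedTV γ t
      ≤ Real.sqrt (P.optEntropy γ * (C * T)) := by
    refine le_sqrt_mul_of_forall_le hH (by positivity) fun l hl => ?_
    calc ∑ t ∈ Finset.range T, P.expectedTV γ t
        ≤ ∑ t ∈ Finset.range T, (l / 2 * (P.expectedEntropy γ t - P.expectedEntropy γ (t + 1))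
            + C / (2 * l)) := Finset.sum_le_sum fun t _ => h t l hl
      _ = l / 2 * (P.optEntropy γ - P.expectedEntropy γ T) + C * T / (2 * l) := by
          rw [Finset.sum_add_distrib, ← Finset.mul_sum, Finset.sum_range_sub',
            P.expectedEntropy_zero hγ, Finset.sum_const, Finset.card_range, nsmul_eq_mul]
          ring
      _ ≤ l / 2 * P.optEntropy γ + C * T / (2 * l) := by
          gcongr
          linarith [P.expectedEntropy_nonneg hγ T]
  calc P.wassersteinBound γ T
      ≤ ∑ t ∈ Finset.range T, ENNReal.ofReal (P.expectedTV γ t) :=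
        Finset.sum_le_sum fun t _ => P.lintegral_wassersteinOne_le_expectedTV hγ t
    _ = ENNReal.ofReal (∑ t ∈ Finset.range T, P.expectedTV γ t) :=
        (ENNReal.ofReal_sum_of_nonneg fun t _ => h0 t).symm
    _ ≤ _ := by
        refine ENNReal.ofReal_le_ofReal (hreal.trans_eq ?_)
        congr 1; ring

end

end PartialFeedbackProblem

theorem corollary5 {S O A Y : Type*} [MeasurableSpace S]
    [MeasurableSpace O] [StandardBorelSpace O] [Nonempty O]
    [Fintype A] [MeasurableSpace A] [DiscreteMeasurableSpace A]
    [MeasurableSpace Y] [StandardBorelSpace Y] [Nonempty Y]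
    (P : PartialFeedbackProblem S O A Y)
    (hr : ∀ (y : A → Y) (a : A), P.reward y a ∈ Set.Icc (0 : ℝ) 1)
    (T : ℕ) (γ : O → A) (hγ : P.IsOptimalRule T γ) :
    P.wassersteinBound γ T ≤
        ENNReal.ofReal (Real.sqrt (1 / 2 * (Fintype.card A : ℝ) * P.optEntropy γ * (T : ℝ))) ∧
      (P.PerfectlyRevealed →
        P.wassersteinBound γ T ≤
          ENNReal.ofReal (Real.sqrt (1 / 2 * P.optEntropy γ * (T : ℝ)))) := by
  exact ⟨P.wassersteinBound_le_sqrt hγ.1 T (by positivity) fun t _ hl => P.expectedTV_le hγ.1 t hl,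
    fun hP => P.wassersteinBound_le_sqrt hγ.1 T (by norm_num) fun t _ hl =>
      P.expectedTV_le_of_perfectlyRevealed hP hγ.1 t hl⟩
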